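/- **Setting.** Let $V$ be a set of sites with a total order, and let $\Lambda_n=(\Lambda_{s,n},\Lambda_{b,n})$, $n\in\mathbb N$, be finite lattices: $\Lambda_{s,n}\subset V$ is finite, $\Lambda_{b,n}$ is a set of pairs of sites (bonds), and any two sites are connected by a path of bonds. Every finite subset of $V$ is contained in $\Lambda_{s,n}$ for all large $n$. Let ${\rm dist}_n$ be the graph distance of $\Lambda_n$, ${\rm dist}_n(X,Y)=\min_{x\in X,y\in Y}{\rm dist}_n(x,y)$, ${\rm diam}_n(X)=\max_{x,y\in X}{\rm dist}_n(x,y)$, and let ${\rm dist}(X,Y)=\lim_n{\rm dist}_n(X,Y)$ be the distance in the infinite volume (the lower limit if the limit does not exist). Each site $x$ carries a spin space of finite dimension and finitely many fermionic modes; the Hilbert space ${\cal H}_{\Lambda}$ is the tensor product of the spin spaces with the fermionic Fock space (so spin systems and lattice fermion systems are special cases). An observable with finite support $X$ is an operator on ${\cal H}_X$, embedded in the operators on ${\cal H}_{\Lambda}$, $\Lambda\supset X$, in the canonical way. A pair $A_X,B_Y$ of observables is *bosonic* if $X\cap Y=\emptyset$ implies $[A_X,B_Y]=0$. The Hamiltonians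 are $H_{n}=\sum_{X\subset\Lambda_{s,n}}h_X$, where the $h_X$ (which may depend on $n$) are self-adjoint with support $X$ and, if there are fermions, even. Let $A(t)=e^{itH_n}Ae^{-itH_n}$. For $\eta>0$ the interaction is *power-law decaying with exponent $\eta$* if, with constants independent of $n$, for all sites $x,y$, either $$\sum_{X\ni x,y}\|h_X\|\le\frac{\lambda_0}{[1+{\rm dist}_n(x,y)]^{\eta}}\quad\text{and}\quad\sum_{z}\frac1{[1+{\rm dist}_n(x,z)]^{\eta}[1+{\rm dist}_n(z,y)]^{\eta}}\le\frac{p_0}{[1+{\rm dist}_n(x,y)]^{\eta}},$$ or $\sum_{X\ni x}\|h_X\||X|[1+{\rm diam}_n(X)]^{\eta}\le s_1$. For $\mu>0$ it is *exponentially decaying with rate $\mu$* if, with constants independent of $n$, either $\sup_{n,x}\sum_y[1+{\rm dist}_n(x,y)]^{-\eta}<\infty$ for some $\eta>0$ and $\sum_{X\ni x,y}\|h_X\|\le\lambda_0e^{-(\mu+\varepsilon){\rm dist}_n(x,y)}$ for some $\lambda_0,\varepsilon>0$, or $\sum_{X\ni x}\|h_X\||X|e^{\mu\,{\rm diam}_n(X)}\le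 s_1$. There is a *uniform gap* $\Delta E>0$ above the ground state sector if for each $n$ there is a nonempty set $S_n$ of eigenvalues of $H_n$ at the bottom of the spectrum (the energies of the ground state sector) such that $\max_{E,E'\in S_n}|E-E'|\to0$ as $n\to\infty$ and every other eigenvalue lies above all of $S_n$ by at least $\Delta E$. Let $P_{0,n}$ be the spectral projection of $H_n$ for $S_n$. A *ground-state expectation* $\omega$ in the infinite volume is given by $\omega(A)=\lim\langle\Phi_n,A\Phi_n\rangle$ and $\omega(AP_0B)=\lim\langle\Phi_n,AP_{0,n}B\Phi_n\rangle$ for all local observables $A,B$, the limits being taken along some subsequence of the lattices, with normalized vectors $\Phi_n$ in the range of $P_{0,n}$. **Theorem (Clustering of bosonic correlations).** For given lattices and interactions there are positive, strictly increasing functions $\eta\mapsto v_\eta$, on the set of $\eta$ for which the interaction is power-law decaying with exponent $\eta$, and $\mu\mapsto v_\mu$, on the set of $\mu$ for which it is exponentially decaying with rate $\mu$, with the following properties. Let $f(r)=(1+r)^{-\eta}$, $v=v_\eta$ in the first case and $f(r)=e^{-\mu r}$, $v=v_\mu$ in the second. (i) $v$ bounds the group velocity of the information propagation: there is $C$ such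 that for all $n$, all nonempty $X,Y\subset\Lambda_{s,n}$ with ${\rm dist}_n(X,Y)>0$, all bosonic pairs $A_X,B_Y$ and all $t\in\mathbb R$, $$\|[A_X(t),B_Y]\|\le C\,\|A_X\|\,\|B_Y\|\,|X|\,|Y|\,f({\rm dist}_n(X,Y))\,(e^{v|t|}-1).$$ (ii) For every $\Delta E>0$ there is a constant $C$ such that, whenever $\Delta E$ is a uniform gap above the ground state sector, for every ground-state expectation $\omega$ in the infinite volume and every bosonic pair $A_X,B_Y$ with finite nonempty supports $X,Y\subset V$, $$\left|\omega(A_XB_Y)-\tfrac12\left[\omega(A_XP_0B_Y)+\omega(B_YP_0A_X)\right]\right|\le C\,\|A_X\|\,\|B_Y\|\,|X|\,|Y|\times\begin{cases}[1+{\rm dist}(X,Y)]^{-\tilde\eta},&\text{power-law decaying},\\ \exp[-\tilde\mu\,{\rm dist}(X,Y)],&\text{exponentially decaying},\end{cases}$$ where $\tilde\eta=\eta/(1+2v_\eta/\Delta E)$ and $\tilde\mu=\mu/(1+2v_\mu/\Delta E)$. If ${\rm dist}(X,Y)=\infty$, the right-hand side is read as $0$. -/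

import Mathlib

open Filter Topology

open scoped Matrix Matrix.Norms.L2Operator

noncomputable section

namespace LatticeSystem

/-! ### Finite lattices -/

/-- A finite lattice: a finite set of sites and a set of bonds between these sites, such that any
two sites are connected by a path. The sites are taken from a fixed set `V`. -/
structure FiniteLattice (V : Type*) where
  sites : Finset V
  bonds : SimpleGraph V
  mem_of_bond : ∀ x y, bonds.Adj x y → x ∈ sites ∧ y ∈ sites
  connected : ∀ x ∈ sites, ∀ y ∈ sites, bonds.Reachable x y

namespace FiniteLattice

variable {V : Type*} (L : FiniteLattice V)

/-- The graph-theoretic distance (the length of a shortest path). -/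
def dist (x y : V) : ℕ := L.bonds.dist x y

/-- `dist(X,Y) = min {dist(x,y) | x ∈ X, y ∈ Y}` (for nonempty `X`, `Y`). -/
def setDist (X Y : Finset V) : ℕ := sInf {r | ∃ x ∈ X, ∃ y ∈ Y, r = L.dist x y}

/-- `diam(X) = max {dist(x,y) | x, y ∈ X}`. -/
def diam (X : Finset V) : ℕ := (X ×ˢ X).sup fun p => L.dist p.1 p.2

end FiniteLattice

/-- The distance of two finite sets in the infinite-volume limit: the limit of the distances
in the finite lattices (the lower limit, in case the distances do not converge). -/
def limDist {V : Type*} (L : ℕ → FiniteLattice V) (X Y : Finset V) : ℕ∞ :=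
  liminf (fun n => ((L n).setDist X Y : ℕ∞)) atTop

/-! ### State spaces and local observables

Each site `x` carries a spin of dimension `d x` and `m x` fermionic modes, so that the Hilbert
space at `x` is `ℂ^(d x) ⊗ Fock(ℂ^(m x))`, with the orthonormal basis of all
(spin state, set of occupied modes). A quantum spin system is the case `m = 0`; a lattice
fermion system is the case `d = 1`. -/

section Observables

variable {V : Type*} (d m : V → ℕ)

/-- Labels of the basis vectors at the site `x`. -/
abbrev SiteState (x : V) : Type := Fin (d x) × Finset (Fin (m x))

/-- Labels of the basis vectors for the set `X` of sites. For fermions, the basis vector of a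
configuration is obtained from the vacuum by applying the creation operators of the occupied
modes in increasing order of the sites. -/
abbrev Config (X : Finset V) : Type _ := ∀ x : {x // x ∈ X}, SiteState d m x

/-- The operators on the Hilbert space of the finite set `X` of sites, as matrices in the above
orthonormal basis. The norm is the operator norm. These are the observables with support `X`. -/
abbrev LocalOp (X : Finset V) : Type _ := Matrix (Config d m X) (Config d m X) ℂ

variable {d m}

/-- The number of fermions at the site `x`. -/
def occ {X : Finset V} (σ : Config d m X) (x : {x // x ∈ X}) : ℕ := (σ x).2.card

/-- The total number of fermions. -/
def totalOcc {X : Finset V} (σ : Config d m X) : ℕ := ∑ x, occ σ x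

/-- An operator is even if it conserves the fermion number modulo two. All operators of a spin
system are even. -/
def IsEven {X : Finset V} (A : LocalOp d m X) : Prop :=
  ∀ σ τ, A σ τ ≠ 0 → totalOcc σ % 2 = totalOcc τ % 2

/-- Restriction of a configuration. -/
def restrict {X Z : Finset V} (h : X ⊆ Z) (σ : Config d m Z) : Config d m X :=
  fun x => σ ⟨x.1, h x.2⟩

variable [LinearOrder V]

/-- The sign that arises when the creation operators on `X` are moved in front of those
on `Z \ X`. It is `1` for spin systems. -/
def reorderSign (X : Finset V) {Z : Finset V} (σ : Config d m Z) : ℂ :=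
  (-1) ^ (∑ x : {x // x ∈ Z}, ∑ y : {x // x ∈ Z},
    if x.1 ∈ X ∧ y.1 ∉ X ∧ y.1 < x.1 then occ σ x * occ σ y else 0)

/-- The observable `A` with support `X`, as an operator for the larger set `Z ⊇ X` of sites.
For spin systems this is `A ⊗ 1`; for fermion systems it is the embedding that sends the
creation and annihilation operators of each mode in `X` to those of the same mode in `Z`.
(The value is `0` if `X` is not contained in `Z`.) -/
def embed {X : Finset V} (Z : Finset V) (A : LocalOp d m X) : LocalOp d m Z :=
  fun σ τ =>
    open Classical in
    if h : X ⊆ Z then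
      if ∀ x : {x // x ∈ Z}, x.1 ∉ X → σ x = τ x then
        reorderSign X σ * reorderSign X τ * A (restrict h σ) (restrict h τ)
      else 0
    else 0

/-- The product `A_X B_Y`, an observable with support `X ∪ Y`. -/
def prodOp {X Y : Finset V} (A : LocalOp d m X) (B : LocalOp d m Y) : LocalOp d m (X ∪ Y) :=
  embed (X ∪ Y) A * embed (X ∪ Y) B

/-- The pair is bosonic: the observables commute if their supports are disjoint. -/
def IsBosonicPair {X Y : Finset V} (A : LocalOp d m X) (B : LocalOp d m Y) : Prop :=
  Disjoint X Y →
    embed (X ∪ Y) A * embed (X ∪ Y) B = embed (X ∪ Y) B * embed (X ∪ Y) A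

end Observables

/-! ### Hamiltonians -/

section Hamiltonian

variable {V : Type*} (d m : V → ℕ)

/-- An interaction: local Hamiltonians `h_X`, which are self-adjoint and even. -/
structure Interaction where
  op : ∀ X : Finset V, LocalOp d m X
  selfAdjoint : ∀ X, (op X).IsHermitian
  even : ∀ X, IsEven (op X)

variable {d m} [LinearOrder V]

/-- The Hamiltonian `H_Λ = ∑_{X ⊆ Λ} h_X`. -/
def hamiltonian (Λ : Finset V) (h : Interaction d m) : LocalOp d m Λ :=
  ∑ X ∈ Λ.powerset, embed Λ (h.op X)

/-- The time evolution `A(t) = exp(itH) A exp(-itH)`. -/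
def evolve {Λ : Finset V} (H A : LocalOp d m Λ) (t : ℝ) : LocalOp d m Λ :=
  NormedSpace.exp ((Complex.I * t) • H) * A * NormedSpace.exp (-(Complex.I * t) • H)

/-- The spectral projection of `H` for the set `S` of energies. -/
def spectralProj {Λ : Finset V} (H : LocalOp d m Λ) (S : Set ℝ) : LocalOp d m Λ :=
  cfc (S.indicator fun _ => (1 : ℝ)) H

/-- The expectation `⟨Φ, M Φ⟩`. -/
def expect {Λ : Finset V} (Φ : Config d m Λ → ℂ) (M : LocalOp d m Λ) : ℂ :=
  star Φ ⬝ᵥ (M *ᵥ Φ)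

/-! ### Decay of the interactions

All bounds are uniform along the sequence `L n` of finite lattices with the interactions `h n`. -/

variable (L : ℕ → FiniteLattice V) (h : ℕ → Interaction d m)

/-- The metric condition `sup_Λ sup_x ∑_y (1 + dist(x,y))^{-η} < ∞`. -/
def DecaySummable (η : ℝ) : Prop :=
  ∃ K : ℝ, ∀ n, ∀ x ∈ (L n).sites,
    ∑ y ∈ (L n).sites, (1 + (L n).dist x y : ℝ) ^ (-η) ≤ K

/-- Power-law decaying interactions with the exponent `η` (two alternative conditions). -/
def IsPowerLaw (η : ℝ) : Prop :=
  0 < η ∧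
  ((∃ l₀ > 0, ∃ p₀ > 0, ∀ n, ∀ x ∈ (L n).sites, ∀ y ∈ (L n).sites,
      ∑ X ∈ (L n).sites.powerset with x ∈ X ∧ y ∈ X, ‖(h n).op X‖
          ≤ l₀ * (1 + (L n).dist x y : ℝ) ^ (-η) ∧
      ∑ z ∈ (L n).sites, (1 + (L n).dist x z : ℝ) ^ (-η) * (1 + (L n).dist z y : ℝ) ^ (-η)
          ≤ p₀ * (1 + (L n).dist x y : ℝ) ^ (-η)) ∨
   (∃ s₁ > 0, ∀ n, ∀ x ∈ (L n).sites,
      ∑ X ∈ (L n).sites.powerset with x ∈ X,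
        ‖(h n).op X‖ * X.card * (1 + (L n).diam X : ℝ) ^ η ≤ s₁))

/-- Exponentially decaying interactions with the rate `μ` (two alternative conditions). -/
def IsExpDecaying (μ : ℝ) : Prop :=
  0 < μ ∧
  (((∃ η > 0, DecaySummable L η) ∧
    ∃ l₀ > 0, ∃ ε > 0, ∀ n, ∀ x ∈ (L n).sites, ∀ y ∈ (L n).sites,
      ∑ X ∈ (L n).sites.powerset with x ∈ X ∧ y ∈ X, ‖(h n).op X‖
          ≤ l₀ * Real.exp (-(μ + ε) * (L n).dist x y)) ∨
   (∃ s₁ > 0, ∀ n, ∀ x ∈ (L n).sites,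
      ∑ X ∈ (L n).sites.powerset with x ∈ X,
        ‖(h n).op X‖ * X.card * Real.exp (μ * (L n).diam X) ≤ s₁))

/-- `v` bounds the group velocity of the information propagation, relative to the spatial decay
`f`: for bosonic pairs at positive distance `r`,
`‖[A_X(t), B_Y]‖ ≤ C ‖A_X‖ ‖B_Y‖ |X| |Y| f(r) (exp(v|t|) - 1)`,
uniformly along the sequence of lattices. -/
def IsVelocityBound (f : ℕ → ℝ) (v : ℝ) : Prop :=
  ∃ C > 0, ∀ n, ∀ X ⊆ (L n).sites, ∀ Y ⊆ (L n).sites, X.Nonempty → Y.Nonempty →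
    ∀ (A : LocalOp d m X) (B : LocalOp d m Y), IsBosonicPair A B →
      0 < (L n).setDist X Y → ∀ t : ℝ,
        ‖⁅evolve (hamiltonian (L n).sites (h n)) (embed (L n).sites A) t,
            embed (L n).sites B⁆‖
          ≤ C * ‖A‖ * ‖B‖ * X.card * Y.card * f ((L n).setDist X Y)
            * (Real.exp (v * |t|) - 1)

/-! ### Gap and ground states -/

/-- Uniform gap `ΔE` above the ground state sector. The set `S n` consists of the energies of the
ground state sector of `H_Λ`, `Λ = L n`, at the bottom of the spectrum. The width of `S n` tends
to zero, and the rest of the spectrum lies higher at least by `ΔE`. -/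
structure UniformGap (S : ℕ → Set ℝ) (ΔE : ℝ) : Prop where
  pos : 0 < ΔE
  nonempty : ∀ n, (S n).Nonempty
  subset_spectrum : ∀ n, S n ⊆ spectrum ℝ (hamiltonian (L n).sites (h n))
  width : Tendsto (fun n => Metric.diam (S n)) atTop (𝓝 0)
  gap : ∀ n, ∀ E ∈ S n, ∀ E' ∈ spectrum ℝ (hamiltonian (L n).sites (h n)) \ S n, E + ΔE ≤ E'

/-- `ω` is a ground-state expectation in the infinite volume: along some subsequence of the
lattices there are normalized vectors `Φ` in the ground state sectors (with projections `P₀`)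
such that `ω A = lim ⟨Φ, A Φ⟩` and `ωP A B = lim ⟨Φ, A P₀ B Φ⟩` for all local observables;
`ωP A B` is what is written `ω(A P₀ B)`. -/
def IsGroundStateExpectation (S : ℕ → Set ℝ)
    (ω : ∀ {X : Finset V}, LocalOp d m X → ℂ)
    (ωP : ∀ {X Y : Finset V}, LocalOp d m X → LocalOp d m Y → ℂ) : Prop :=
  ∃ k : ℕ → ℕ, StrictMono k ∧ ∃ Φ : ∀ n, Config d m (L n).sites → ℂ,
    (∀ n, star (Φ n) ⬝ᵥ Φ n = 1) ∧
    (∀ n, spectralProj (hamiltonian (L n).sites (h n)) (S n) *ᵥ Φ n = Φ n) ∧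
    (∀ (X : Finset V) (A : LocalOp d m X),
      Tendsto (fun j => expect (Φ (k j)) (embed (L (k j)).sites A)) atTop (𝓝 (ω A))) ∧
    (∀ (X Y : Finset V) (A : LocalOp d m X) (B : LocalOp d m Y),
      Tendsto (fun j => expect (Φ (k j))
        (embed (L (k j)).sites A
          * spectralProj (hamiltonian (L (k j)).sites (h (k j))) (S (k j))
          * embed (L (k j)).sites B)) atTop (𝓝 (ωP A B)))

/-- The clustering bound with the spatial decay `g`. The constant `C` is independent of the
ground-state expectation, of the observables and of their supports. -/
def BosonicClustering (ΔE : ℝ) (g : ℕ → ℝ) : Prop :=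
  ∃ C > 0, ∀ S : ℕ → Set ℝ, UniformGap L h S ΔE →
    ∀ (ω : ∀ {X : Finset V}, LocalOp d m X → ℂ)
      (ωP : ∀ {X Y : Finset V}, LocalOp d m X → LocalOp d m Y → ℂ),
      IsGroundStateExpectation L h S ω ωP →
      ∀ (X Y : Finset V), X.Nonempty → Y.Nonempty →
      ∀ (A : LocalOp d m X) (B : LocalOp d m Y), IsBosonicPair A B →
      ∀ r : ℕ, (r : ℕ∞) ≤ limDist L X Y →
        ‖ω (prodOp A B) - (1 / 2) * (ωP A B + ωP B A)‖
          ≤ C * ‖A‖ * ‖B‖ * X.card * Y.card * g r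

end Hamiltonian

end LatticeSystem

end

open LatticeSystem

/-! Two mechanisms carry the theorem: a Lieb–Robinson bound, and a Gaussian filter in time that
turns the spectral gap into spatial decay.

Propagation. In the interaction picture of the terms that commute with `A`, the norm of `[A, B(-t)]`
changes only through the terms that do not. Applied to each term `T Z` of the Hamiltonian, this
gives a closed linear system of differential inequalities for the commutators `[T Z, B(-t)]`. It is
not iterated into a series but compared with a supersolution: `q Z = ‖h_Z‖ ∑_{z ∈ Z} u z` with `u z
= ∑_{y ∈ Y} f (dist z y)`. If convolution of the coupling with `f` is at most `κ f`, Grönwall's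
inequality in the `q`-weighted sup norm gives growth `exp (2κt)` (`norm_lie_term_le`,
`norm_lie_conjExp_le`, `norm_lie_evolve_le`). All decay hypotheses yield such a `κ`. The velocity is
the infimum of the admissible ones plus the exponent or rate itself, which makes it strictly
increasing (`velocity`).

Clustering. Let `Φ` lie in the ground state sector, with energies near `E₀`. Up to the width of the
sector, `⟨[A(t), B]⟩` equals `⟨A e^{-it(H-E₀)} B⟩ - ⟨B e^{it(H-E₀)} A⟩`. Subtracting the values at
`t` and `-t` leaves the symmetrized correlation through `sin (t(H-E₀))`. Integrated against `exp
(-αt²)/t` over `t > 0`, the sine becomes nearly `0` on the sector and nearly `π/2` above the gap,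
that is, nearly `(π/2)(1 - P₀)`. As `A` and `B` commute, this produces `ω(AB) - ½[ω(AP₀B) +
ω(BP₀A)]`. The time integral is small: for `t ≤ T` by the Lieb–Robinson bound, for `t > T` by the
Gaussian (`norm_sum_sineTransform_le`, `norm_quadForm_mul_sub_le`).

With `f = exp (-F)`, the choice of `α` and `T` in `IsVelocityBound.bosonicClustering` balances all
errors at `exp (-F r / (1 + 2v/ΔE))`, which is the source of the reduced exponents. The width of the
sector disappears in the infinite-volume limit. -/

noncomputable section

namespace LatticeSystem

/-! ### Embedding of local observables and fermionic signs -/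

section Embedding

variable {V : Type*} {d m : V → ℕ}

/-- The configurations agree outside `X`. -/
def AgreeOff (X : Finset V) {Z : Finset V} (σ τ : Config d m Z) : Prop :=
  ∀ x : {x // x ∈ Z}, x.1 ∉ X → σ x = τ x

lemma AgreeOff.symm {X Z : Finset V} {σ τ : Config d m Z} (h : AgreeOff X σ τ) :
    AgreeOff X τ σ := fun x hx => (h x hx).symm

lemma AgreeOff.trans {X Z : Finset V} {σ τ ρ : Config d m Z} (h : AgreeOff X σ τ)
    (h' : AgreeOff X τ ρ) : AgreeOff X σ ρ := fun x hx => (h x hx).trans (h' x hx)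

variable [LinearOrder V]

/-- The configuration that is `ρ` on `X` and `σ` elsewhere. -/
def merge {X Z : Finset V} (ρ : Config d m X) (σ : Config d m Z) : Config d m Z :=
  fun x => if h : x.1 ∈ X then ρ ⟨x.1, h⟩ else σ x

lemma agreeOff_merge {X Z : Finset V} (ρ : Config d m X) (σ : Config d m Z) :
    AgreeOff X σ (merge ρ σ) := fun x hx => by simp [merge, hx]

lemma restrict_merge {X Z : Finset V} (h : X ⊆ Z) (ρ : Config d m X)
    (σ : Config d m Z) : restrict h (merge ρ σ) = ρ := by
  funext x
  simp [restrict, merge, x.2]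

lemma merge_restrict {X Z : Finset V} (h : X ⊆ Z) {σ τ : Config d m Z}
    (hστ : AgreeOff X σ τ) : merge (restrict h τ) σ = τ := by
  funext x
  by_cases hx : x.1 ∈ X
  · simp [restrict, merge, hx]
  · simp [merge, hx, hστ x hx]

-- In products of embedded operators only those intermediate configurations contribute that differ
-- from `σ` inside `X` alone; `merge` parametrizes them by the configurations on `X`.
open Classical in
lemma sum_agreeOff {X Z : Finset V} (h : X ⊆ Z) (σ : Config d m Z) (F : Config d m Z → ℂ) :
    ∑ ρ, (if AgreeOff X σ ρ then F ρ else 0) = ∑ ρ : Config d m X, F (merge ρ σ) := by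
  rw [← Finset.sum_filter]
  refine Finset.sum_nbij' (fun ρ => restrict h ρ) (fun ρ => merge ρ σ) ?_ ?_ ?_ ?_ ?_
  · simp
  · simp [agreeOff_merge]
  · intro ρ hρ
    simp only [Finset.mem_filter, Finset.mem_univ, true_and] at hρ
    exact merge_restrict h hρ
  · intro ρ _
    exact restrict_merge h ρ σ
  · intro ρ hρ
    simp only [Finset.mem_filter, Finset.mem_univ, true_and] at hρ
    simp only [merge_restrict h hρ]

open Classical in
/-- The fermion number at the site `x`, as a function on all sites. -/
def occAt {Z : Finset V} (σ : Config d m Z) (x : V) : ℕ :=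
  if h : x ∈ Z then occ σ ⟨x, h⟩ else 0

lemma occAt_coe {Z : Finset V} (σ : Config d m Z) (x : {x // x ∈ Z}) :
    occAt σ x.1 = occ σ x := by
  simp [occAt, x.2]

lemma occAt_restrict {X Z : Finset V} (h : X ⊆ Z) (σ : Config d m Z) {x : V} (hx : x ∈ X) :
    occAt (restrict h σ) x = occAt σ x := by
  simp [occAt, hx, h hx, occ, restrict]

lemma AgreeOff.occAt_eq {X Z : Finset V} {σ τ : Config d m Z} (h : AgreeOff X σ τ) {x : V}
    (hx : x ∉ X) : occAt σ x = occAt τ x := by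
  unfold occAt
  split_ifs with hz
  · simp [occ, h ⟨x, hz⟩ hx]
  · rfl

lemma totalOcc_restrict {X Z : Finset V} (h : X ⊆ Z) (σ : Config d m Z) :
    totalOcc (restrict h σ) = ∑ x ∈ X, occAt σ x := by
  rw [totalOcc, ← Finset.sum_coe_sort X]
  refine Finset.sum_congr rfl fun x _ => ?_
  rw [← occAt_coe, occAt_restrict h σ x.2]

/-- The exponent of the reordering sign. -/
def reorderExp (X Z : Finset V) (n : V → ℕ) : ℕ :=
  ∑ x ∈ Z, ∑ y ∈ Z, if x ∈ X ∧ y ∉ X ∧ y < x then n x * n y else 0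

lemma reorderSign_eq (X : Finset V) {Z : Finset V} (σ : Config d m Z) :
    reorderSign X σ = (-1) ^ reorderExp X Z (occAt σ) := by
  unfold reorderSign reorderExp
  congr 1
  rw [← Finset.sum_coe_sort Z]
  refine Finset.sum_congr rfl fun x _ => ?_
  rw [← Finset.sum_coe_sort Z]
  refine Finset.sum_congr rfl fun y _ => ?_
  rw [occAt_coe, occAt_coe]

lemma reorderSign_mul_self (X : Finset V) {Z : Finset V} (σ : Config d m Z) :
    reorderSign X σ * reorderSign X σ = 1 := by
  rw [reorderSign_eq, ← mul_pow]
  norm_num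

lemma star_reorderSign (X : Finset V) {Z : Finset V} (σ : Config d m Z) :
    star (reorderSign X σ) = reorderSign X σ := by
  rw [reorderSign_eq]
  simp

open Classical in
lemma embed_apply {X Z : Finset V} (h : X ⊆ Z) (A : LocalOp d m X) (σ τ : Config d m Z) :
    embed Z A σ τ = if AgreeOff X σ τ then
      reorderSign X σ * reorderSign X τ * A (restrict h σ) (restrict h τ) else 0 := by
  unfold embed
  rw [dif_pos h]
  by_cases hστ : AgreeOff X σ τ
  · rw [if_pos hστ]
    exact if_pos hστ
  · rw [if_neg hστ]
    exact if_neg hστ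

lemma embed_add {X Z : Finset V} (A B : LocalOp d m X) :
    embed Z (A + B) = embed Z A + embed Z B := by
  ext σ τ
  simp only [embed, Matrix.add_apply]
  split_ifs <;> ring

lemma embed_smul {X Z : Finset V} (c : ℂ) (A : LocalOp d m X) :
    embed Z (c • A) = c • embed Z A := by
  ext σ τ
  simp only [embed, Matrix.smul_apply, smul_eq_mul]
  split_ifs <;> ring

lemma embed_zero {X Z : Finset V} : embed Z (0 : LocalOp d m X) = 0 := by
  ext σ τ
  simp [embed]

lemma embed_star {X Z : Finset V} (A : LocalOp d m X) :
    embed Z (star A) = star (embed Z A) := by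
  classical
  by_cases h : X ⊆ Z
  · ext σ τ
    rw [Matrix.star_apply, embed_apply h, embed_apply h, Matrix.star_apply]
    by_cases hστ : AgreeOff X σ τ
    · rw [if_pos hστ, if_pos hστ.symm, star_mul', star_mul', star_reorderSign, star_reorderSign]
      ring
    · rw [if_neg hστ, if_neg (fun h => hστ h.symm), star_zero]
  · ext σ τ
    simp [embed, h]

lemma embed_mul {X Z : Finset V} (A B : LocalOp d m X) :
    embed Z (A * B) = embed Z A * embed Z B := by
  classical
  by_cases h : X ⊆ Z
  · ext σ τ
    rw [Matrix.mul_apply]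
    have h1 : ∀ ρ, embed Z A σ ρ * embed Z B ρ τ = if AgreeOff X σ ρ then
        (if AgreeOff X σ τ then reorderSign X σ * reorderSign X τ *
          (A (restrict h σ) (restrict h ρ) * B (restrict h ρ) (restrict h τ)) else 0) else 0 := by
      intro ρ
      rw [embed_apply h, embed_apply h]
      by_cases h1 : AgreeOff X σ ρ
      · by_cases h2 : AgreeOff X σ τ
        · rw [if_pos h1, if_pos h1, if_pos h2, if_pos (h1.symm.trans h2)]
          linear_combination (reorderSign X σ * reorderSign X τ *
            A (restrict h σ) (restrict h ρ) * B (restrict h ρ) (restrict h τ)) *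
            reorderSign_mul_self X ρ
        · rw [if_neg h2, if_neg (c := AgreeOff X ρ τ) fun h3 => h2 (h1.trans h3)]
          simp
      · simp [h1]
    simp_rw [h1]
    rw [sum_agreeOff h, embed_apply h]
    split_ifs
    · simp_rw [restrict_merge h, ← Finset.mul_sum]
      rw [Matrix.mul_apply]
    · simp
  · ext σ τ
    rw [Matrix.mul_apply]
    simp [embed, h]

/-- The embedding of observables as a homomorphism of star algebras. -/
def embedHom (X Z : Finset V) : LocalOp d m X →⋆ₙₐ[ℂ] LocalOp d m Z where
  toFun := embed Z
  map_smul' := embed_smul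
  map_zero' := embed_zero
  map_add' := embed_add
  map_mul' := embed_mul
  map_star' := embed_star

/-- Star homomorphisms between C⋆-algebras are contractive, so no norm of a tensor product has to be
computed. -/
lemma norm_embed_le {X : Finset V} (Z : Finset V) (A : LocalOp d m X) : ‖embed Z A‖ ≤ ‖A‖ :=
  NonUnitalStarAlgHom.norm_apply_le (embedHom X Z) A

/-- Reordering in two stages differs from reordering at once by a sign that counts pairs in `(W \ X)
× (Z \ W)`. This sign depends only on occupations outside `X`, where `σ` and `τ` agree, so it occurs
twice and cancels. -/
lemma embed_embed {X W Z : Finset V} (hXW : X ⊆ W) (hWZ : W ⊆ Z) (A : LocalOp d m X) :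
    embed Z (embed W A) = embed Z A := by
  classical
  ext σ τ
  rw [embed_apply hWZ, embed_apply hXW, embed_apply (hXW.trans hWZ)]
  by_cases h : AgreeOff X σ τ
  · have h1 : AgreeOff W σ τ := fun x hx => h x fun hx' => hx (hXW hx')
    have h2 : AgreeOff X (restrict hWZ σ) (restrict hWZ τ) := fun x hx => h ⟨x.1, hWZ x.2⟩ hx
    rw [if_pos h1, if_pos h2, if_pos h]
    have key : ∀ σ : Config d m Z, reorderSign W σ * reorderSign X (restrict hWZ σ) =
        reorderSign X σ * (-1) ^ (∑ x ∈ Z, ∑ y ∈ Z, if x ∈ W ∧ x ∉ X ∧ y ∉ W ∧ y < x then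
          occAt σ x * occAt σ y else 0) := by
      intro σ
      rw [reorderSign_eq, reorderSign_eq, reorderSign_eq, ← pow_add, ← pow_add]
      congr 1
      have e : reorderExp X W (occAt (restrict hWZ σ)) = ∑ x ∈ Z, ∑ y ∈ Z,
          if x ∈ W ∧ y ∈ W ∧ x ∈ X ∧ y ∉ X ∧ y < x then occAt σ x * occAt σ y else 0 := by
        unfold reorderExp
        rw [← Finset.sum_subset hWZ]
        · refine Finset.sum_congr rfl fun x hx => ?_
          rw [← Finset.sum_subset hWZ]
          · refine Finset.sum_congr rfl fun y hy => ?_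
            rw [occAt_restrict hWZ σ hx, occAt_restrict hWZ σ hy]
            simp [hx, hy]
          · intro y _ hy
            simp [hy]
        · intro x _ hx
          simp [hx]
      rw [e]
      unfold reorderExp
      rw [← Finset.sum_add_distrib, ← Finset.sum_add_distrib]
      refine Finset.sum_congr rfl fun x _ => ?_
      rw [← Finset.sum_add_distrib, ← Finset.sum_add_distrib]
      refine Finset.sum_congr rfl fun y _ => ?_
      have hx := @hXW x
      have hy := @hXW y
      by_cases a1 : x ∈ X <;> by_cases a2 : y ∈ X <;> by_cases a3 : x ∈ W <;>
        by_cases a4 : y ∈ W <;> simp_all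
    have hc : (∑ x ∈ Z, ∑ y ∈ Z, if x ∈ W ∧ x ∉ X ∧ y ∉ W ∧ y < x then
          occAt σ x * occAt σ y else 0) = ∑ x ∈ Z, ∑ y ∈ Z,
          if x ∈ W ∧ x ∉ X ∧ y ∉ W ∧ y < x then occAt τ x * occAt τ y else 0 := by
      refine Finset.sum_congr rfl fun x _ => Finset.sum_congr rfl fun y _ => ?_
      by_cases hxy : x ∈ W ∧ x ∉ X ∧ y ∉ W ∧ y < x
      · rw [if_pos hxy, if_pos hxy, h.occAt_eq hxy.2.1, h1.occAt_eq hxy.2.2.1]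
      · rw [if_neg hxy, if_neg hxy]
    have k1 := key σ
    have k2 := key τ
    rw [hc] at k1
    set c := ∑ x ∈ Z, ∑ y ∈ Z, if x ∈ W ∧ x ∉ X ∧ y ∉ W ∧ y < x then
          occAt τ x * occAt τ y else 0
    have hc1 : ((-1 : ℂ) ^ c) * (-1) ^ c = 1 := by rw [← mul_pow]; norm_num
    change _ = reorderSign X σ * reorderSign X τ *
      A (restrict hXW (restrict hWZ σ)) (restrict hXW (restrict hWZ τ))
    set a := A (restrict hXW (restrict hWZ σ)) (restrict hXW (restrict hWZ τ))
    calc reorderSign W σ * reorderSign W τ * (reorderSign X (restrict hWZ σ) *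
          reorderSign X (restrict hWZ τ) * a)
        = (reorderSign W σ * reorderSign X (restrict hWZ σ)) *
          (reorderSign W τ * reorderSign X (restrict hWZ τ)) * a := by ring
      _ = (reorderSign X σ * reorderSign X τ * a) * ((-1) ^ c * (-1) ^ c) := by
          rw [k1, k2]; ring
      _ = _ := by rw [hc1, mul_one]
  · rw [if_neg h]
    by_cases h1 : AgreeOff W σ τ
    · rw [if_pos h1, if_neg, mul_zero]
      intro h2
      refine h fun x hx => ?_
      by_cases hxW : x.1 ∈ W
      · exact h2 ⟨x.1, hxW⟩ hx
      · exact h1 x hxW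
    · rw [if_neg h1]

-- For disjoint supports a single intermediate configuration survives: `τ` on `X` and `σ` elsewhere.
open Classical in
lemma embed_mul_embed_apply {X Y Z : Finset V} (hX : X ⊆ Z) (hY : Y ⊆ Z) (hXY : Disjoint X Y)
    (A : LocalOp d m X) (B : LocalOp d m Y) (σ τ : Config d m Z) :
    (embed Z A * embed Z B) σ τ = if AgreeOff (X ∪ Y) σ τ then
      reorderSign X σ * reorderSign X (merge (restrict hX τ) σ) *
        (reorderSign Y (merge (restrict hX τ) σ) * reorderSign Y τ) *
        (A (restrict hX σ) (restrict hX τ) * B (restrict hY σ) (restrict hY τ)) else 0 := by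
  have hY' : ∀ ρ : Config d m X, restrict hY (merge ρ σ) = restrict hY σ := by
    intro ρ
    funext y
    have : y.1 ∉ X := fun h => Finset.disjoint_left.1 hXY h y.2
    simp [restrict, merge, this]
  rw [Matrix.mul_apply]
  have h1 : ∀ ρ, embed Z A σ ρ * embed Z B ρ τ = if AgreeOff X σ ρ then
      embed Z A σ ρ * embed Z B ρ τ else 0 := by
    intro ρ
    by_cases h : AgreeOff X σ ρ
    · rw [if_pos h]
    · rw [if_neg h, embed_apply hX, if_neg h, zero_mul]
  rw [Finset.sum_congr rfl fun ρ _ => h1 ρ, sum_agreeOff hX]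
  have h2 : ∀ ρ : Config d m X, ρ ≠ restrict hX τ →
      embed Z A σ (merge ρ σ) * embed Z B (merge ρ σ) τ = 0 := by
    intro ρ hρ
    rw [embed_apply hY, if_neg, mul_zero]
    intro h
    refine hρ ?_
    funext x
    have hxY : x.1 ∉ Y := Finset.disjoint_left.1 hXY x.2
    have := h ⟨x.1, hX x.2⟩ hxY
    simpa [merge, x.2, restrict] using this
  rw [Finset.sum_eq_single (restrict hX τ) (fun ρ _ hρ => h2 ρ hρ) (by simp)]
  rw [embed_apply hX, if_pos (agreeOff_merge _ _), embed_apply hY, restrict_merge, hY']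
  have h3 : AgreeOff Y (merge (restrict hX τ) σ) τ ↔ AgreeOff (X ∪ Y) σ τ := by
    refine forall_congr' fun x => ?_
    by_cases hx : x.1 ∈ X
    · simp [hx, merge, restrict]
    · simp [hx, merge]
  by_cases h : AgreeOff (X ∪ Y) σ τ
  · rw [if_pos h, if_pos (h3.2 h)]
    ring
  · rw [if_neg h, if_neg (h3.not.2 h), mul_zero]

/-- The contribution of one pair of sites `(x, y)` to the difference, modulo two, of the sign
exponents of `AB` and `BA`; `s` and `t` are the occupations in the two configurations. Only pairs in
`X × Y` contribute, which leaves a finite check in `ZMod 2`. -/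
lemma reorder_term {xX xY yX yY lt gt : Prop} [Decidable xX] [Decidable xY] [Decidable yX]
    [Decidable yY] [Decidable lt] [Decidable gt] {sx tx sy ty : ZMod 2}
    (hx : ¬xX → ¬xY → sx = tx) (hy : ¬yX → ¬yY → sy = ty) (hxd : xX → ¬xY) (hyd : yX → ¬yY)
    (ho : xX → yY → (gt ↔ ¬lt)) :
    (if xX ∧ ¬yX ∧ gt then sx * sy else 0) + (if xX ∧ ¬yX ∧ gt then
        (if xX then tx else sx) * (if yX then ty else sy) else 0) +
      ((if yY ∧ ¬xY ∧ lt then (if yX then ty else sy) * (if xX then tx else sx) else 0) +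
        (if yY ∧ ¬xY ∧ lt then ty * tx else 0)) -
      ((if yY ∧ ¬xY ∧ lt then sy * sx else 0) +
        (if yY ∧ ¬xY ∧ lt then (if yY then ty else sy) * (if xY then tx else sx) else 0) +
      ((if xX ∧ ¬yX ∧ gt then (if xY then tx else sx) * (if yY then ty else sy) else 0) +
        (if xX ∧ ¬yX ∧ gt then tx * ty else 0))) =
      if xX ∧ yY then (sx + tx) * (sy + ty) else 0 := by
  by_cases h1 : xX
  · have h2 := hxd h1
    by_cases h3 : yY
    · have h4 : ¬yX := fun h => hyd h h3
      by_cases h5 : lt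
      · simp only [ho h1 h3, h1, h2, h3, h4, h5, not_true, not_false_eq_true, and_true,
          and_false, if_true, if_false]
        clear hx hy
        revert sx tx sy ty
        decide
      · simp only [ho h1 h3, h1, h2, h3, h4, h5, not_false_eq_true, and_true, and_false,
          if_true, if_false]
        clear hx hy
        revert sx tx sy ty
        decide
    · by_cases h4 : yX
      · simp [h3, h4]
      · simp [h1, h2, h3, h4, hy h4 h3]
  · by_cases h3 : yY
    · have h4 : ¬yX := fun h => hyd h h3
      by_cases h2 : xY
      · simp [h1, h2]
      · simp [h1, h2, h3, h4, hx h1 h2]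
    · simp [h1, h3]

/-- The two orders of the product differ by `(-1)` to the power (change of fermion number in `X`)
times (change in `Y`), and the first factor is even wherever `A` has a nonzero entry. -/
lemma embed_commute_of_isEven {X Y Z : Finset V} (hX : X ⊆ Z) (hY : Y ⊆ Z)
    (hXY : Disjoint X Y) {A : LocalOp d m X} (hA : IsEven A) (B : LocalOp d m Y) :
    Commute (embed Z A) (embed Z B) := by
  classical
  unfold Commute SemiconjBy
  ext σ τ
  rw [embed_mul_embed_apply hX hY hXY, embed_mul_embed_apply hY hX hXY.symm,
    Finset.union_comm Y X]
  by_cases h : AgreeOff (X ∪ Y) σ τ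
  swap
  · rw [if_neg h, if_neg h]
  rw [if_pos h, if_pos h]
  by_cases hA0 : A (restrict hX σ) (restrict hX τ) = 0
  · rw [hA0]; ring
  have hpar := hA _ _ hA0
  rw [totalOcc_restrict, totalOcc_restrict] at hpar
  rw [mul_comm (B _ _)]
  congr 1
  simp_rw [reorderSign_eq, ← pow_add]
  have hn1 : ∀ x, occAt (merge (restrict hX τ) σ) x = if x ∈ X then occAt τ x else occAt σ x := by
    intro x
    unfold occAt
    by_cases hx : x ∈ X
    · simp [hX hx, hx, occ, merge, restrict]
    · simp [hx, occ, merge]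
  have hn2 : ∀ x, occAt (merge (restrict hY τ) σ) x = if x ∈ Y then occAt τ x else occAt σ x := by
    intro x
    unfold occAt
    by_cases hx : x ∈ Y
    · simp [hY hx, hx, occ, merge, restrict]
    · simp [hx, occ, merge]
  have hoff : ∀ x, x ∉ X → x ∉ Y → occAt σ x = occAt τ x := fun x h1 h2 =>
    h.occAt_eq (by simp [h1, h2])
  generalize occAt (merge (restrict hX τ) σ) = n1 at *
  generalize occAt (merge (restrict hY τ) σ) = n2 at *
  generalize occAt σ = s at *
  generalize occAt τ = t at *
  have hxy : ∀ x, x ∈ X → x ∉ Y := fun x hx => Finset.disjoint_left.1 hXY hx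
  have hz : ((reorderExp X Z s + reorderExp X Z n1 + (reorderExp Y Z n1 + reorderExp Y Z t) : ℕ)
      : ZMod 2) = ((reorderExp Y Z s + reorderExp Y Z n2 +
        (reorderExp X Z n2 + reorderExp X Z t) : ℕ) : ZMod 2) := by
    have hp : ((∑ x ∈ X, (s x + t x) : ℕ) : ZMod 2) = 0 := by
      rw [ZMod.natCast_eq_zero_iff, Finset.sum_add_distrib]
      omega
    rw [← sub_eq_zero]
    have : (((reorderExp X Z s + reorderExp X Z n1 + (reorderExp Y Z n1 + reorderExp Y Z t) : ℕ)
      : ZMod 2) - ((reorderExp Y Z s + reorderExp Y Z n2 +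
        (reorderExp X Z n2 + reorderExp X Z t) : ℕ) : ZMod 2)) =
        (((∑ x ∈ X, (s x + t x) : ℕ) : ZMod 2)) * ((∑ y ∈ Y, (s y + t y) : ℕ) : ZMod 2) := by
      -- The roles of the summation variables are exchanged in the exponents for `Y`, so that all
      -- terms can be compared pair by pair with `x` on the side of `X`.
      have swapY : ∀ n, (reorderExp Y Z n : ZMod 2) = ((∑ x ∈ Z, ∑ y ∈ Z,
          if y ∈ Y ∧ x ∉ Y ∧ x < y then n y * n x else 0 : ℕ) : ZMod 2) := by
        intro n
        unfold reorderExp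
        rw [Finset.sum_comm]
      have hprod : (((∑ x ∈ X, (s x + t x) : ℕ) : ZMod 2)) *
          ((∑ y ∈ Y, (s y + t y) : ℕ) : ZMod 2) = ∑ x ∈ Z, ∑ y ∈ Z,
            if x ∈ X ∧ y ∈ Y then ((s x : ZMod 2) + t x) * (s y + t y) else 0 := by
        push_cast
        rw [Finset.sum_mul_sum, ← Finset.sum_subset hX]
        · refine Finset.sum_congr rfl fun x hx => ?_
          rw [← Finset.sum_subset hY]
          · refine Finset.sum_congr rfl fun y hy => ?_
            simp [hx, hy]
          · intro y _ hy
            simp [hy]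
        · intro x _ hx
          simp [hx]
      rw [hprod]
      push_cast
      simp only [swapY]
      unfold reorderExp
      push_cast
      simp only [← Finset.sum_add_distrib, ← Finset.sum_sub_distrib]
      refine Finset.sum_congr rfl fun x _ => Finset.sum_congr rfl fun y _ => ?_
      rw [hn1 x, hn1 y, hn2 x, hn2 y]
      simp only [Nat.cast_ite]
      refine reorder_term (fun h1 h2 => congrArg Nat.cast (hoff x h1 h2))
        (fun h1 h2 => congrArg Nat.cast (hoff y h1 h2)) (hxy x) (hxy y) fun hx hy => ?_
      rcases lt_or_gt_of_ne (fun h => hxy x hx (h ▸ hy) : x ≠ y) with hlt | hgt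
      · simp [hlt, not_lt.2 hlt.le]
      · simp [hgt, not_lt.2 hgt.le]
    rw [this, hp, zero_mul]
  rw [ZMod.natCast_eq_natCast_iff'] at hz
  rw [neg_one_pow_eq_pow_mod_two, hz, ← neg_one_pow_eq_pow_mod_two]

lemma embed_prodOp {X Y Z : Finset V} (hX : X ⊆ Z) (hY : Y ⊆ Z) (A : LocalOp d m X)
    (B : LocalOp d m Y) : embed Z (prodOp A B) = embed Z A * embed Z B := by
  rw [prodOp, embed_mul, embed_embed Finset.subset_union_left (Finset.union_subset hX hY),
    embed_embed Finset.subset_union_right (Finset.union_subset hX hY)]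

lemma norm_prodOp_le {X Y : Finset V} (A : LocalOp d m X) (B : LocalOp d m Y) :
    ‖prodOp A B‖ ≤ ‖A‖ * ‖B‖ :=
  (norm_mul_le _ _).trans (mul_le_mul (norm_embed_le _ A) (norm_embed_le _ B) (norm_nonneg _)
    (norm_nonneg _))

lemma IsBosonicPair.commute_embed {X Y Z : Finset V} (hX : X ⊆ Z) (hY : Y ⊆ Z)
    (hXY : Disjoint X Y) {A : LocalOp d m X} {B : LocalOp d m Y} (h : IsBosonicPair A B) :
    Commute (embed Z A) (embed Z B) := by
  have h1 := congrArg (embed Z) (h hXY)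
  rwa [embed_mul, embed_mul, embed_embed Finset.subset_union_left (Finset.union_subset hX hY),
    embed_embed Finset.subset_union_right (Finset.union_subset hX hY)] at h1

end Embedding

/-! ### Commutator growth in a C⋆-algebra -/

section Dynamics

variable {𝔄 : Type*} [CStarAlgebra 𝔄]

/-- The time evolution in a C⋆-algebra, generated by `K`. -/
def conjExp (K : 𝔄) (t : ℝ) (a : 𝔄) : 𝔄 :=
  NormedSpace.exp ((Complex.I * t) • K) * a * NormedSpace.exp (-(Complex.I * t) • K)

lemma exp_smul_mul_exp_neg_smul (K : 𝔄) (c : ℂ) :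
    NormedSpace.exp (c • K) * NormedSpace.exp (-c • K) = 1 := by
  let _ : NormedAlgebra ℚ 𝔄 := NormedAlgebra.restrictScalars ℚ ℂ 𝔄
  rw [← NormedSpace.exp_add_of_commute, neg_smul, add_neg_cancel, NormedSpace.exp_zero]
  exact ((Commute.refl K).smul_left _).smul_right _

lemma exp_neg_smul_mul_exp_smul (K : 𝔄) (c : ℂ) :
    NormedSpace.exp (-c • K) * NormedSpace.exp (c • K) = 1 := by
  simpa using exp_smul_mul_exp_neg_smul K (-c)

lemma exp_I_smul_mem_unitary {K : 𝔄} (hK : IsSelfAdjoint K) (t : ℝ) :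
    NormedSpace.exp ((Complex.I * t) • K) ∈ unitary 𝔄 := by
  let _ : NormedAlgebra ℚ 𝔄 := NormedAlgebra.restrictScalars ℚ ℂ 𝔄
  have h : star (NormedSpace.exp ((Complex.I * t) • K)) =
      NormedSpace.exp (-(Complex.I * t) • K) := by
    rw [NormedSpace.star_exp, star_smul, hK.star_eq]
    simp
  rw [Unitary.mem_iff, h]
  exact ⟨exp_neg_smul_mul_exp_smul K _, exp_smul_mul_exp_neg_smul K _⟩

lemma norm_conjExp {K : 𝔄} (hK : IsSelfAdjoint K) (t : ℝ) (a : 𝔄) :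
    ‖conjExp K t a‖ = ‖a‖ := by
  have h1 := exp_I_smul_mem_unitary hK t
  have h2 : NormedSpace.exp (-(Complex.I * t) • K) ∈ unitary 𝔄 := by
    simpa using exp_I_smul_mem_unitary hK (-t)
  rw [conjExp, CStarRing.norm_mul_mem_unitary _ h2, CStarRing.norm_mem_unitary_mul _ h1]

lemma conjExp_zero (K a : 𝔄) : conjExp K 0 a = a := by
  simp [conjExp]

lemma conjExp_mul (K : 𝔄) (t : ℝ) (a b : 𝔄) :
    conjExp K t (a * b) = conjExp K t a * conjExp K t b := by
  unfold conjExp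
  simp only [mul_assoc]
  rw [← mul_assoc (NormedSpace.exp (-(Complex.I * t) • K)) (NormedSpace.exp _),
    exp_neg_smul_mul_exp_smul, one_mul]

lemma conjExp_sub (K : 𝔄) (t : ℝ) (a b : 𝔄) :
    conjExp K t (a - b) = conjExp K t a - conjExp K t b := by
  simp [conjExp, mul_sub, sub_mul]

lemma conjExp_smul (K : 𝔄) (t : ℝ) (c : ℂ) (a : 𝔄) :
    conjExp K t (c • a) = c • conjExp K t a := by
  simp [conjExp]

lemma conjExp_lie (K : 𝔄) (t : ℝ) (a b : 𝔄) :
    conjExp K t ⁅a, b⁆ = ⁅conjExp K t a, conjExp K t b⁆ := by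
  simp only [Ring.lie_def, conjExp_sub, conjExp_mul]

lemma conjExp_self (K : 𝔄) (t : ℝ) : conjExp K t K = K := by
  have h : Commute (NormedSpace.exp ((Complex.I * t) • K)) K :=
    ((Commute.refl K).smul_left _).exp_left
  rw [conjExp, h.eq, mul_assoc, exp_smul_mul_exp_neg_smul, mul_one]

lemma conjExp_neg_conjExp (K : 𝔄) (t : ℝ) (a : 𝔄) : conjExp (-K) t (conjExp K t a) = a := by
  unfold conjExp
  rw [smul_neg, ← neg_smul, smul_neg, ← neg_smul, neg_neg]
  calc _ = (NormedSpace.exp (-(Complex.I * t) • K) * NormedSpace.exp ((Complex.I * t) • K)) * a *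
      (NormedSpace.exp (-(Complex.I * t) • K) * NormedSpace.exp ((Complex.I * t) • K)) := by
        simp only [mul_assoc]
    _ = a := by rw [exp_neg_smul_mul_exp_smul, one_mul, mul_one]

lemma hasDerivAt_conjExp (K : 𝔄) {g : ℝ → 𝔄} {g' : 𝔄} {t : ℝ} (hg : HasDerivAt g g' t) :
    HasDerivAt (fun s => conjExp K s (g s)) (conjExp K t (g' + Complex.I • ⁅K, g t⁆)) t := by
  have e1 : ∀ s : ℝ, (Complex.I * s) • K = s • (Complex.I • K) := fun s => by
    rw [mul_comm, mul_smul]; simp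
  have e2 : ∀ s : ℝ, (-(Complex.I * s)) • K = s • (-(Complex.I • K)) := fun s => by
    rw [neg_smul, e1, smul_neg]
  have h1 := hasDerivAt_exp_smul_const (𝕂 := ℝ) (Complex.I • K) t
  have h2 := hasDerivAt_exp_smul_const' (𝕂 := ℝ) (-(Complex.I • K)) t
  simp only [← e1, ← e2] at h1 h2
  have h3 := (h1.mul hg).mul h2
  refine h3.congr_deriv ?_
  simp only [Pi.mul_apply, conjExp, Ring.lie_def, smul_sub, mul_add, add_mul, mul_sub, sub_mul,
    smul_mul_assoc, mul_smul_comm, neg_mul, mul_neg, mul_assoc]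
  abel

lemma norm_lie_le_two_mul (a b : 𝔄) : ‖⁅a, b⁆‖ ≤ 2 * ‖a‖ * ‖b‖ := by
  rw [Ring.lie_def]
  calc _ ≤ ‖a * b‖ + ‖b * a‖ := norm_sub_le _ _
    _ ≤ ‖a‖ * ‖b‖ + ‖b‖ * ‖a‖ := add_le_add (norm_mul_le _ _) (norm_mul_le _ _)
    _ = _ := by ring

variable {ι : Type*} [Fintype ι]

/-- The commutator of `A` with an evolving observable, in the interaction picture of the terms
of the Hamiltonian outside `R`. -/
def interactionLie (T : ι → 𝔄) (R : Finset ι) (A B : 𝔄) (t : ℝ) : 𝔄 :=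
  conjExp (∑ Z, T Z - ∑ Z ∈ R, T Z) t ⁅A, conjExp (-∑ Z, T Z) t B⁆

lemma isSelfAdjoint_sum_sub {T : ι → 𝔄} (hT : ∀ Z, IsSelfAdjoint (T Z)) (R : Finset ι) :
    IsSelfAdjoint (∑ Z, T Z - ∑ Z ∈ R, T Z) :=
  (isSelfAdjoint_sum _ fun Z _ => hT Z).sub (isSelfAdjoint_sum _ fun Z _ => hT Z)

lemma norm_interactionLie {T : ι → 𝔄} (hT : ∀ Z, IsSelfAdjoint (T Z)) (R : Finset ι) (A B : 𝔄)
    (t : ℝ) : ‖interactionLie T R A B t‖ = ‖⁅A, conjExp (-∑ Z, T Z) t B⁆‖ :=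
  norm_conjExp (isSelfAdjoint_sum_sub hT R) t _

/-- The terms outside `R` commute with `A`, so by the Jacobi identity their part of `[A, [-H,
B(-t)]]` is cancelled by the outer evolution. What remains involves only commutators of `B(-t)` with
terms in `R`, hence can be fed back into the same estimate. -/
lemma hasDerivAt_interactionLie (T : ι → 𝔄) {R : Finset ι} {A : 𝔄}
    (hA : ∀ Z ∉ R, Commute (T Z) A) (B : 𝔄) (t : ℝ) :
    HasDerivAt (interactionLie T R A B) (conjExp (∑ Z, T Z - ∑ Z ∈ R, T Z) t
      (-Complex.I • ⁅A, ∑ Z ∈ R, ⁅T Z, conjExp (-∑ Z, T Z) t B⁆⁆)) t := by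
  set H := ∑ Z, T Z with hH
  set HR := ∑ Z ∈ R, T Z with hHR
  have h1 := hasDerivAt_conjExp (-H) (hasDerivAt_const t B)
  have h2 : HasDerivAt (fun s => ⁅A, conjExp (-H) s B⁆)
      ⁅A, conjExp (-H) t (0 + Complex.I • ⁅-H, B⁆)⁆ t := by
    simp only [Ring.lie_def]
    exact (h1.const_mul A).sub (h1.mul_const A)
  refine (hasDerivAt_conjExp (H - HR) h2).congr_deriv ?_
  congr 1
  rw [zero_add, conjExp_smul, conjExp_lie, conjExp_self]
  have h3 : ∑ Z ∈ R, ⁅T Z, conjExp (-H) t B⁆ = ⁅HR, conjExp (-H) t B⁆ := by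
    simp only [Ring.lie_def, hHR, Finset.sum_mul, Finset.mul_sum, Finset.sum_sub_distrib]
  have h4 : Commute (H - HR) A := by
    classical
    have : H - HR = ∑ Z ∈ Rᶜ, T Z := by
      rw [hH, hHR, ← Finset.sum_add_sum_compl R T]; abel
    rw [this]
    exact Commute.sum_left _ _ _ fun Z hZ => hA Z (Finset.mem_compl.1 hZ)
  rw [h3]
  generalize conjExp (-H) t B = b
  have key : ⁅A, ⁅-H, b⁆⁆ + ⁅H - HR, ⁅A, b⁆⁆ = -⁅A, ⁅HR, b⁆⁆ := by
    have h6 : ⁅A, ⁅-H, b⁆⁆ + ⁅H - HR, ⁅A, b⁆⁆ + ⁅A, ⁅HR, b⁆⁆ =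
        ((H - HR) * A - A * (H - HR)) * b - b * ((H - HR) * A - A * (H - HR)) := by
      simp only [Ring.lie_def]
      noncomm_ring
    rw [h4.eq, sub_self, zero_mul, mul_zero, sub_zero] at h6
    exact eq_neg_of_add_eq_zero_left h6
  rw [neg_smul, ← smul_neg, ← key, smul_add]
  congr 1
  generalize ⁅-H, b⁆ = x
  simp only [Ring.lie_def, mul_smul_comm, smul_mul_assoc, smul_sub]

lemma norm_deriv_interactionLie_le {T : ι → 𝔄} (hT : ∀ Z, IsSelfAdjoint (T Z)) (R : Finset ι)
    (A : 𝔄) (b : ι → 𝔄) (t : ℝ) :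
    ‖conjExp (∑ Z, T Z - ∑ Z ∈ R, T Z) t (-Complex.I • ⁅A, ∑ Z ∈ R, b Z⁆)‖ ≤
      2 * ‖A‖ * ∑ Z ∈ R, ‖b Z‖ := by
  rw [norm_conjExp (isSelfAdjoint_sum_sub hT R), norm_smul, norm_neg, Complex.norm_I, one_mul]
  refine (norm_lie_le_two_mul _ _).trans ?_
  gcongr
  exact norm_sum_le _ _

/-- Propagation bound for the commutators with the terms of the Hamiltonian, given a
supersolution `q`. -/
lemma norm_lie_term_le {T : ι → 𝔄} (hT : ∀ Z, IsSelfAdjoint (T Z)) (R : ι → Finset ι)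
    (hR : ∀ Z, ∀ W ∉ R Z, Commute (T W) (T Z)) (B : 𝔄) {q : ι → ℝ} (hq : ∀ Z, 0 ≤ q Z)
    (hq0 : ∀ Z, q Z = 0 → ∀ a, Commute (T Z) a) (hB : ∀ Z, ‖⁅T Z, B⁆‖ ≤ 2 * ‖B‖ * q Z)
    {v : ℝ} (hv : 0 ≤ v) (hqv : ∀ Z, 2 * ‖T Z‖ * ∑ W ∈ R Z, q W ≤ v * q Z) {t : ℝ} (ht : 0 ≤ t)
    (Z : ι) :
    ‖⁅T Z, conjExp (-∑ W, T W) t B⁆‖ ≤ 2 * ‖B‖ * q Z * Real.exp (v * t) := by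
  set b : ℝ → 𝔄 := fun s => conjExp (-∑ W, T W) s B
  -- Dividing by `q` turns the system of inequalities into one Grönwall inequality for the sup norm
  -- over `Z`. Where `q Z = 0` the component is `0` by `inv_zero`; nothing is lost, since there
  -- `hq0` makes the commutator vanish.
  let f : ℝ → ι → 𝔄 := fun s Z => (q Z)⁻¹ • interactionLie T (R Z) (T Z) B s
  let f' : ℝ → ι → 𝔄 := fun s Z => (q Z)⁻¹ • conjExp (∑ W, T W - ∑ W ∈ R Z, T W) s
    (-Complex.I • ⁅T Z, ∑ W ∈ R Z, ⁅T W, b s⁆⁆)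
  have hf : ∀ s, HasDerivAt f (f' s) s := fun s => hasDerivAt_pi.2 fun Z =>
    (hasDerivAt_interactionLie T (hR Z) B s).const_smul _
  have hle : ∀ s Z, ‖⁅T Z, b s⁆‖ ≤ q Z * ‖f s‖ := by
    intro s Z
    rcases eq_or_lt_of_le (hq Z) with h | h
    · have := (hq0 Z h.symm (b s)).lie_eq
      rw [this, ← h]
      simp
    · have h1 := norm_le_pi_norm (f s) Z
      have h2 : ‖f s Z‖ = (q Z)⁻¹ * ‖⁅T Z, b s⁆‖ := by
        simp only [f]
        rw [norm_smul, norm_interactionLie hT, Real.norm_of_nonneg (inv_nonneg.2 (hq Z))]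
      rw [h2, inv_mul_le_iff₀ h] at h1
      exact h1
  have hG := norm_le_gronwallBound_of_norm_deriv_right_le (f := f) (f' := f') (a := 0) (b := t)
    (δ := 2 * ‖B‖) (K := v) (ε := 0) (fun s _ => (hf s).continuousAt.continuousWithinAt)
    (fun s _ => (hf s).hasDerivWithinAt) ?_ ?_ t ⟨ht, le_rfl⟩
  · rw [gronwallBound_ε0, sub_zero] at hG
    refine (hle t Z).trans ?_
    calc q Z * ‖f t‖ ≤ q Z * (2 * ‖B‖ * Real.exp (v * t)) := by gcongr; exact hq Z
      _ = _ := by ring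
  · refine (pi_norm_le_iff_of_nonneg (by positivity)).2 fun Z => ?_
    simp only [f]
    rw [norm_smul, norm_interactionLie hT, Real.norm_of_nonneg (inv_nonneg.2 (hq Z)),
      conjExp_zero]
    rcases eq_or_lt_of_le (hq Z) with h | h
    · rw [← h]
      simp
    · rw [inv_mul_le_iff₀ h]
      linarith [hB Z]
  · intro s _
    rw [add_zero]
    refine (pi_norm_le_iff_of_nonneg (by positivity)).2 fun Z => ?_
    simp only [f']
    rw [norm_smul, Real.norm_of_nonneg (inv_nonneg.2 (hq Z))]
    rcases eq_or_lt_of_le (hq Z) with h | h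
    · rw [← h, inv_zero, zero_mul]
      positivity
    · rw [inv_mul_le_iff₀ h]
      calc _ ≤ 2 * ‖T Z‖ * ∑ W ∈ R Z, ‖⁅T W, b s⁆‖ := norm_deriv_interactionLie_le hT _ _ _ _
        _ ≤ 2 * ‖T Z‖ * ∑ W ∈ R Z, q W * ‖f s‖ := by
          gcongr with W _
          exact hle s W
        _ = (2 * ‖T Z‖ * ∑ W ∈ R Z, q W) * ‖f s‖ := by rw [← Finset.sum_mul]; ring
        _ ≤ (v * q Z) * ‖f s‖ := mul_le_mul_of_nonneg_right (hqv Z) (norm_nonneg _)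
        _ = _ := by ring

/-- Lieb–Robinson bound in terms of a supersolution `q`. -/
lemma norm_lie_conjExp_le {T : ι → 𝔄} (hT : ∀ Z, IsSelfAdjoint (T Z)) (R : ι → Finset ι)
    (hR : ∀ Z, ∀ W ∉ R Z, Commute (T W) (T Z)) {A B : 𝔄} (hAB : Commute A B) {q : ι → ℝ}
    (hq : ∀ Z, 0 ≤ q Z) (hq0 : ∀ Z, q Z = 0 → ∀ a, Commute (T Z) a)
    (hB : ∀ Z, ‖⁅T Z, B⁆‖ ≤ 2 * ‖B‖ * q Z) {v : ℝ} (hv : 0 < v)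
    (hqv : ∀ Z, 2 * ‖T Z‖ * ∑ W ∈ R Z, q W ≤ v * q Z) (RA : Finset ι)
    (hRA : ∀ Z ∉ RA, Commute (T Z) A) {t : ℝ} (ht : 0 ≤ t) :
    ‖⁅conjExp (∑ Z, T Z) t A, B⁆‖ ≤
      4 * ‖A‖ * ‖B‖ * (∑ Z ∈ RA, q Z) / v * (Real.exp (v * t) - 1) := by
  -- The isometric backward evolution moves the time dependence from `A` to `B`.
  have h0 : ‖⁅conjExp (∑ Z, T Z) t A, B⁆‖ = ‖interactionLie T RA A B t‖ := by
    rw [norm_interactionLie hT, ← norm_conjExp (isSelfAdjoint_sum _ fun Z _ => hT Z).neg t,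
      conjExp_lie, conjExp_neg_conjExp]
  rw [h0]
  have hd : ∀ s, HasDerivAt (fun s => 4 * ‖A‖ * ‖B‖ * (∑ Z ∈ RA, q Z) / v *
      (Real.exp (v * s) - 1)) (4 * ‖A‖ * ‖B‖ * (∑ Z ∈ RA, q Z) * Real.exp (v * s)) s := by
    intro s
    have h1 : HasDerivAt (fun s => Real.exp (v * s)) (Real.exp (v * s) * (v * 1)) s :=
      ((hasDerivAt_id s).const_mul v).exp
    refine ((h1.sub_const 1).const_mul _).congr_deriv ?_
    field_simp
  refine image_norm_le_of_norm_deriv_right_le_deriv_boundary (a := 0) (b := t)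
    (fun s _ => (hasDerivAt_interactionLie T hRA B s).continuousAt.continuousWithinAt)
    (fun s _ => (hasDerivAt_interactionLie T hRA B s).hasDerivWithinAt) ?_ hd ?_ ⟨ht, le_rfl⟩
  · rw [norm_interactionLie hT, conjExp_zero, hAB.lie_eq]
    simp
  · intro s hs
    refine (norm_deriv_interactionLie_le hT _ _ _ _).trans ?_
    calc _ ≤ 2 * ‖A‖ * ∑ Z ∈ RA, 2 * ‖B‖ * q Z * Real.exp (v * s) := by
          gcongr with Z _
          exact norm_lie_term_le hT R hR B hq hq0 hB hv.le hqv hs.1 Z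
      _ = _ := by
          rw [← Finset.sum_mul, ← Finset.mul_sum]; ring

end Dynamics

/-! ### Lieb–Robinson bound on a finite lattice -/

lemma conjExp_ofReal_smul {𝔄 : Type*} [CStarAlgebra 𝔄] (K : 𝔄) (s t : ℝ) (a : 𝔄) :
    conjExp ((s : ℂ) • K) t a = conjExp K (s * t) a := by
  have h : Complex.I * t * s = Complex.I * ((s * t : ℝ) : ℂ) := by
    push_cast
    ring
  simp only [conjExp, smul_smul, neg_mul, h]

section Propagation

variable {V : Type*} {d m : V → ℕ}

/-- The total strength of the interactions that involve both `x` and `y`. -/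
def coupling [DecidableEq V] (Λ : Finset V) (h : Interaction d m) (x y : V) : ℝ :=
  ∑ X ∈ Λ.powerset with x ∈ X ∧ y ∈ X, ‖h.op X‖

variable [LinearOrder V]

lemma evolve_eq_conjExp {Λ : Finset V} (H A : LocalOp d m Λ) (t : ℝ) :
    evolve H A t = conjExp H t A := rfl

lemma embed_self {Λ : Finset V} (A : LocalOp d m Λ) : embed Λ A = A := by
  ext σ τ
  have hoff : AgreeOff Λ σ τ := fun x hx => absurd x.2 hx
  have h : ∀ σ : Config d m Λ, reorderSign Λ σ = 1 := by
    intro σ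
    simp [reorderSign]
  rw [embed_apply Finset.Subset.rfl, if_pos hoff, h, h, one_mul, one_mul]
  rfl

lemma sum_coupling_mul (Λ : Finset V) (h : Interaction d m) (x : V) (u : V → ℝ) :
    ∑ w ∈ Λ, coupling Λ h x w * u w =
      ∑ W ∈ Λ.powerset with x ∈ W, ‖h.op W‖ * ∑ w ∈ W, u w := by
  simp only [coupling, Finset.sum_mul, Finset.sum_filter, Finset.mul_sum]
  rw [Finset.sum_comm]
  refine Finset.sum_congr rfl fun W hW => ?_
  by_cases hx : x ∈ W
  · simp only [hx, true_and, if_true]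
    rw [← Finset.sum_subset (Finset.mem_powerset.1 hW)]
    · exact Finset.sum_congr rfl fun w hw => by simp [hw]
    · intro w _ hw
      simp [hw]
  · simp [hx]

/-- A union bound: every `W` that meets `X` is counted at some common site, which reduces the sum
over sets to the site inequality `hκ`. -/
lemma sum_not_disjoint_le {Λ X : Finset V} (hX : X ⊆ Λ) (h : Interaction d m) {u : V → ℝ}
    (hu : ∀ x, 0 ≤ u x) {κ : ℝ}
    (hκ : ∀ z ∈ Λ, ∑ w ∈ Λ, coupling Λ h z w * u w ≤ κ * u z) :
    ∑ W ∈ Λ.powerset with ¬Disjoint W X, ‖h.op W‖ * ∑ w ∈ W, u w ≤ κ * ∑ x ∈ X, u x := by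
  calc _ ≤ ∑ W ∈ Λ.powerset, ∑ x ∈ X, if x ∈ W then ‖h.op W‖ * ∑ w ∈ W, u w else 0 := by
        rw [Finset.sum_filter]
        refine Finset.sum_le_sum fun W _ => ?_
        have hn : 0 ≤ ‖h.op W‖ * ∑ w ∈ W, u w :=
          mul_nonneg (norm_nonneg _) (Finset.sum_nonneg fun w _ => hu w)
        have hn' : ∀ x ∈ X, 0 ≤ if x ∈ W then ‖h.op W‖ * ∑ w ∈ W, u w else 0 := fun x _ => by
          split_ifs <;> simp [hn]
        by_cases hd : Disjoint W X
        · rw [if_neg (not_not.2 hd)]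
          exact Finset.sum_nonneg hn'
        · rw [if_pos hd]
          obtain ⟨x, hxW, hxX⟩ := Finset.not_disjoint_iff.1 hd
          refine le_trans ?_ (Finset.single_le_sum hn' hxX)
          rw [if_pos hxW]
    _ = ∑ x ∈ X, ∑ w ∈ Λ, coupling Λ h x w * u w := by
        rw [Finset.sum_comm]
        simp only [sum_coupling_mul, Finset.sum_filter]
    _ ≤ ∑ x ∈ X, κ * u x := Finset.sum_le_sum fun x hx => hκ x (hX hx)
    _ = _ := by rw [Finset.mul_sum]

/-- Lieb–Robinson bound for a site weight `u` that is a supersolution for the coupling. -/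
lemma norm_lie_evolve_le {Λ X Y : Finset V} (hX : X ⊆ Λ) (hY : Y ⊆ Λ) (hXY : Disjoint X Y)
    (h : Interaction d m) {A : LocalOp d m X} {B : LocalOp d m Y} (hAB : IsBosonicPair A B)
    {u : V → ℝ} (hu : ∀ x, 0 < u x) (huY : ∀ y ∈ Y, 1 ≤ u y) {κ : ℝ} (hκ0 : 0 < κ)
    (hκ : ∀ z ∈ Λ, ∑ w ∈ Λ, coupling Λ h z w * u w ≤ κ * u z) (t : ℝ) :
    ‖⁅evolve (hamiltonian Λ h) (embed Λ A) t, embed Λ B⁆‖ ≤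
      2 * ‖A‖ * ‖B‖ * (∑ x ∈ X, u x) * (Real.exp (2 * κ * |t|) - 1) := by
  -- The sign of `t` is absorbed into the generator, so that only nonnegative times need to be
  -- treated.
  obtain ⟨s, hs, hst⟩ : ∃ s : ℝ, |s| = 1 ∧ t = s * |t| := by
    rcases le_total 0 t with h | h
    · exact ⟨1, by simp, by simp [abs_of_nonneg h]⟩
    · exact ⟨-1, by simp, by simp [abs_of_nonpos h]⟩
  let T : {Z // Z ∈ Λ.powerset} → LocalOp d m Λ := fun Z => (s : ℂ) • embed Λ (h.op Z)
  have hsub : ∀ Z : {Z // Z ∈ Λ.powerset}, Z.1 ⊆ Λ := fun Z => Finset.mem_powerset.1 Z.2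
  let q : {Z // Z ∈ Λ.powerset} → ℝ := fun Z => ‖h.op Z.1‖ * ∑ z ∈ Z.1, u z
  let R : Finset V → Finset {Z // Z ∈ Λ.powerset} := fun X =>
    Finset.univ.filter fun W => ¬Disjoint W.1 X
  have hu0 : ∀ Z : Finset V, 0 ≤ ∑ z ∈ Z, u z := fun Z => Finset.sum_nonneg fun z _ => (hu z).le
  have hH : ∑ Z, T Z = (s : ℂ) • hamiltonian Λ h := by
    rw [hamiltonian, Finset.smul_sum]
    exact Finset.sum_coe_sort Λ.powerset fun Z => (s : ℂ) • embed Λ (h.op Z)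
  have hTn : ∀ Z, ‖T Z‖ ≤ ‖h.op Z.1‖ := fun Z => by
    simp only [T]
    rw [norm_smul, Complex.norm_real, Real.norm_eq_abs, hs, one_mul]
    exact norm_embed_le _ _
  have hT : ∀ Z, IsSelfAdjoint (T Z) := fun Z => by
    have h1 : star (embed Λ (h.op Z.1)) = embed Λ (h.op Z.1) := by
      rw [← embed_star]
      exact congrArg _ (h.selfAdjoint Z.1)
    simp only [T, IsSelfAdjoint]
    rw [star_smul, h1]
    simp
  have hcomm : ∀ (Z : {Z // Z ∈ Λ.powerset}) {X : Finset V}, X ⊆ Λ → Disjoint Z.1 X →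
      ∀ A : LocalOp d m X, Commute (T Z) (embed Λ A) := fun Z X hX hZ A =>
    (embed_commute_of_isEven (hsub Z) hX hZ (h.even Z) A).smul_left _
  have hRsum : ∀ X : Finset V, X ⊆ Λ → ∑ W ∈ R X, q W ≤ κ * ∑ x ∈ X, u x := by
    intro X hX
    have h1 : ∑ W ∈ R X, q W =
        ∑ W ∈ Λ.powerset with ¬Disjoint W X, ‖h.op W‖ * ∑ w ∈ W, u w := by
      simp only [R, q, Finset.sum_filter]
      exact Finset.sum_coe_sort Λ.powerset fun W =>
        if ¬Disjoint W X then ‖h.op W‖ * ∑ w ∈ W, u w else 0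
    rw [h1]
    exact sum_not_disjoint_le hX h (fun x => (hu x).le) hκ
  have hq : ∀ Z, 0 ≤ q Z := fun Z => mul_nonneg (norm_nonneg _) (hu0 _)
  have hmem : ∀ (X : Finset V) Z, Z ∉ R X → Disjoint Z.1 X := fun X Z hZ => by
    simpa [R] using hZ
  have main := norm_lie_conjExp_le hT (fun Z => R Z.1)
    (fun Z W hW => (hcomm W (hsub Z) (hmem _ _ hW) (h.op Z.1)).smul_right _)
    (hAB.commute_embed hX hY hXY) hq ?_ ?_ (v := 2 * κ) (by positivity) ?_ (R X)
    (fun Z hZ => hcomm Z hX (hmem _ _ hZ) A) (abs_nonneg t)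
  · rw [evolve_eq_conjExp]
    rw [hH, conjExp_ofReal_smul, ← hst] at main
    refine main.trans ?_
    have he : 0 ≤ Real.exp (2 * κ * |t|) - 1 :=
      sub_nonneg.2 (Real.one_le_exp (by positivity))
    refine mul_le_mul_of_nonneg_right ?_ he
    rw [div_le_iff₀ (by positivity)]
    calc _ ≤ 4 * ‖A‖ * ‖B‖ * (κ * ∑ x ∈ X, u x) := by
          have h1 := norm_embed_le Λ A
          have h2 := norm_embed_le Λ B
          have h3 := hRsum X hX
          have h4 : 0 ≤ ∑ Z ∈ R X, q Z := Finset.sum_nonneg fun Z _ => hq Z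
          exact mul_le_mul (mul_le_mul (mul_le_mul_of_nonneg_left h1 (by norm_num)) h2
            (norm_nonneg _) (mul_nonneg (by norm_num) (norm_nonneg _))) h3 h4
            (mul_nonneg (mul_nonneg (by norm_num) (norm_nonneg _)) (norm_nonneg _))
      _ = _ := by ring
  · intro Z hZ a
    rcases mul_eq_zero.1 hZ with h0 | h0
    · have : T Z = 0 := norm_le_zero_iff.1 ((hTn Z).trans h0.le)
      rw [this]
      exact Commute.zero_left a
    -- As `u > 0`, the weight can also vanish for `Z = ∅`; an even operator with empty support
    -- commutes with everything, its support being disjoint from `Λ`.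
    · have : Z.1 = ∅ := by
        by_contra hne
        exact (Finset.sum_pos (fun z _ => hu z) (Finset.nonempty_iff_ne_empty.2 hne)).ne' h0
      have h1 := hcomm Z Finset.Subset.rfl (by simp [this]) a
      rwa [embed_self] at h1
  · intro Z
    by_cases hZ : Disjoint Z.1 Y
    · rw [(hcomm Z hY hZ B).lie_eq, norm_zero]
      exact mul_nonneg (by positivity) (hq Z)
    · obtain ⟨y, hyZ, hyY⟩ := Finset.not_disjoint_iff.1 hZ
      have h1 : 1 ≤ ∑ z ∈ Z.1, u z :=
        (huY y hyY).trans (Finset.single_le_sum (fun z _ => (hu z).le) hyZ)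
      calc _ ≤ 2 * ‖T Z‖ * ‖embed Λ B‖ := norm_lie_le_two_mul _ _
        _ ≤ 2 * (‖h.op Z.1‖ * ∑ z ∈ Z.1, u z) * ‖embed Λ B‖ := by
          gcongr
          exact (hTn Z).trans (le_mul_of_one_le_right (norm_nonneg _) h1)
        _ = _ := by ring
  · intro Z
    calc 2 * ‖T Z‖ * ∑ W ∈ R Z.1, q W ≤ 2 * ‖h.op Z.1‖ * (κ * ∑ z ∈ Z.1, u z) := by
          have h4 : 0 ≤ ∑ W ∈ R Z.1, q W := Finset.sum_nonneg fun Z _ => hq Z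
          exact mul_le_mul (mul_le_mul_of_nonneg_left (hTn Z) (by norm_num)) (hRsum Z.1 (hsub Z))
            h4 (mul_nonneg (by norm_num) (norm_nonneg _))
      _ = _ := by simp only [q]; ring

end Propagation

/-! ### Velocity bounds from the decay hypotheses -/

section Velocity

lemma FiniteLattice.dist_triangle {V : Type*} (L : FiniteLattice V) {x y : V} (hx : x ∈ L.sites)
    (hy : y ∈ L.sites) (z : V) : L.dist x z ≤ L.dist x y + L.dist y z :=
  (L.connected x hx y hy).dist_triangle_left z

lemma FiniteLattice.setDist_le {V : Type*} (L : FiniteLattice V) {X Y : Finset V} {x y : V}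
    (hx : x ∈ X) (hy : y ∈ Y) : L.setDist X Y ≤ L.dist x y :=
  Nat.sInf_le ⟨x, hx, y, hy, rfl⟩

lemma FiniteLattice.disjoint_of_setDist_pos {V : Type*} (L : FiniteLattice V) {X Y : Finset V}
    (h : 0 < L.setDist X Y) : Disjoint X Y := by
  rw [Finset.disjoint_left]
  intro x hX hY
  have := L.setDist_le hX hY
  simp [FiniteLattice.dist] at this
  omega

lemma FiniteLattice.dist_le_diam {V : Type*} (L : FiniteLattice V) {X : Finset V} {x y : V}
    (hx : x ∈ X) (hy : y ∈ X) : L.dist x y ≤ L.diam X :=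
  Finset.le_sup (f := fun p : V × V => L.dist p.1 p.2) (b := (x, y))
    (Finset.mem_product.2 ⟨hx, hy⟩)

variable {V : Type*} {d m : V → ℕ} [LinearOrder V] {L : ℕ → FiniteLattice V}
  {h : ℕ → Interaction d m}

/-- The weight `u z = ∑_{y ∈ Y} f (dist z y)` is at least `1` on `Y` because `f 0 = 1`, and inherits
the supersolution inequality from `f` by linearity. Its sum over `X` produces the factor `|X| |Y| f
(dist X Y)`. -/
lemma isVelocityBound_of_kernel {f : ℕ → ℝ} (hf : Antitone f) (hf0 : f 0 = 1)
    (hpos : ∀ r, 0 < f r) {κ : ℝ} (hκ0 : 0 < κ)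
    (hκ : ∀ n, ∀ z ∈ (L n).sites, ∀ y ∈ (L n).sites, ∑ w ∈ (L n).sites,
      coupling (L n).sites (h n) z w * f ((L n).dist w y) ≤ κ * f ((L n).dist z y)) :
    IsVelocityBound L h f (2 * κ) := by
  refine ⟨2, two_pos, fun n X hX Y hY _ hYne A B hAB hd t => ?_⟩
  have hdis := (L n).disjoint_of_setDist_pos hd
  refine (norm_lie_evolve_le hX hY hdis (h n) hAB (u := fun z => ∑ y ∈ Y, f ((L n).dist z y))
    (fun x => Finset.sum_pos (fun y _ => hpos _) hYne) ?_ hκ0 ?_ t).trans ?_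
  · intro y hy
    refine le_trans ?_ (Finset.single_le_sum (fun y _ => (hpos _).le) hy)
    simp [FiniteLattice.dist, hf0]
  · intro z hz
    simp only [Finset.mul_sum]
    rw [Finset.sum_comm]
    exact Finset.sum_le_sum fun y hy => hκ n z hz y (hY hy)
  · have hs : ∑ x ∈ X, ∑ y ∈ Y, f ((L n).dist x y) ≤
        X.card * Y.card * f ((L n).setDist X Y) := by
      calc _ ≤ ∑ x ∈ X, ∑ y ∈ Y, f ((L n).setDist X Y) :=
            Finset.sum_le_sum fun x hx => Finset.sum_le_sum fun y hy =>
              hf ((L n).setDist_le hx hy)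
        _ = _ := by simp [mul_assoc]
    have he : 0 ≤ Real.exp (2 * κ * |t|) - 1 :=
      sub_nonneg.2 (Real.one_le_exp (by positivity))
    have hn : 0 ≤ 2 * ‖A‖ * ‖B‖ := by positivity
    calc _ ≤ 2 * ‖A‖ * ‖B‖ * (X.card * Y.card * f ((L n).setDist X Y)) *
          (Real.exp (2 * κ * |t|) - 1) :=
          mul_le_mul_of_nonneg_right (mul_le_mul_of_nonneg_left hs hn) he
      _ = _ := by ring

/-- Moving from `z` to another site of `W ∋ z` shortens the distance to `y` by at most `diam W`,
which costs a factor `g (diam W)`; summing over the sites of `W` gives `|W|`. -/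
lemma isVelocityBound_of_diam {f : ℕ → ℝ} (hf : Antitone f) (hf0 : f 0 = 1)
    (hpos : ∀ r, 0 < f r) {g : ℕ → ℝ} (hg : ∀ a b c, c ≤ a + b → f b ≤ g a * f c) {s : ℝ}
    (hs0 : 0 < s) (hs : ∀ n, ∀ x ∈ (L n).sites, ∑ X ∈ (L n).sites.powerset with x ∈ X,
      ‖(h n).op X‖ * X.card * g ((L n).diam X) ≤ s) :
    IsVelocityBound L h f (2 * s) := by
  refine isVelocityBound_of_kernel hf hf0 hpos hs0 fun n z hz y _ => ?_
  rw [sum_coupling_mul _ _ _ fun w => f ((L n).dist w y)]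
  calc _ ≤ ∑ W ∈ (L n).sites.powerset with z ∈ W,
        ‖(h n).op W‖ * W.card * g ((L n).diam W) * f ((L n).dist z y) := by
        refine Finset.sum_le_sum fun W hW => ?_
        rw [Finset.mem_filter, Finset.mem_powerset] at hW
        rw [mul_assoc, mul_assoc]
        refine mul_le_mul_of_nonneg_left ?_ (norm_nonneg _)
        calc _ ≤ ∑ w ∈ W, g ((L n).diam W) * f ((L n).dist z y) := by
              refine Finset.sum_le_sum fun w hw => hg _ _ _ ?_
              have h1 := (L n).dist_triangle hz (hW.1 hw) y
              have h2 := (L n).dist_le_diam hW.2 hw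
              omega
          _ = _ := by simp
    _ ≤ s * f ((L n).dist z y) := by
        rw [← Finset.sum_mul]
        exact mul_le_mul_of_nonneg_right (hs n z hz) (hpos _).le

lemma rpow_neg_antitone {η : ℝ} (hη : 0 < η) : Antitone fun r : ℕ => (1 + r : ℝ) ^ (-η) := by
  intro a b hab
  have : (a : ℝ) ≤ b := by exact_mod_cast hab
  exact Real.rpow_le_rpow_of_nonpos (by positivity) (by linarith) (by linarith)

lemma exp_neg_mul_antitone {μ : ℝ} (hμ : 0 < μ) : Antitone fun r : ℕ => Real.exp (-μ * r) := by
  intro a b hab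
  have : (a : ℝ) ≤ b := by exact_mod_cast hab
  refine Real.exp_le_exp.2 ?_
  nlinarith

lemma IsPowerLaw.exists_isVelocityBound {η : ℝ} (hη : IsPowerLaw L h η) :
    ∃ v > 0, IsVelocityBound L h (fun r => (1 + r : ℝ) ^ (-η)) v := by
  obtain ⟨hη0, ⟨l, hl, p, hp, hlp⟩ | ⟨s, hs, hs'⟩⟩ := hη
  · refine ⟨2 * (l * p), by positivity, isVelocityBound_of_kernel (rpow_neg_antitone hη0)
      (by simp) (fun r => by positivity) (by positivity) fun n z hz y hy => ?_⟩
    calc _ ≤ ∑ w ∈ (L n).sites, l * ((1 + (L n).dist z w : ℝ) ^ (-η) *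
          (1 + (L n).dist w y : ℝ) ^ (-η)) := by
          refine Finset.sum_le_sum fun w hw => ?_
          rw [← mul_assoc]
          exact mul_le_mul_of_nonneg_right (hlp n z hz w hw).1 (by positivity)
      _ ≤ _ := by
          rw [← Finset.mul_sum, mul_assoc]
          exact mul_le_mul_of_nonneg_left (hlp n z hz y hy).2 hl.le
  · refine ⟨2 * s, by positivity, isVelocityBound_of_diam (rpow_neg_antitone hη0)
      (by simp) (fun r => by positivity) (g := fun a => (1 + a : ℝ) ^ η) ?_ hs hs'⟩
    intro a b c hc
    -- Power laws satisfy the required comparison because `1 + r` is submultiplicative along the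
    -- triangle inequality.
    have h1 : (1 + c : ℝ) ≤ (1 + a) * (1 + b) := by
      have : (c : ℝ) ≤ a + b := by exact_mod_cast hc
      nlinarith [mul_nonneg (Nat.cast_nonneg (α := ℝ) a) (Nat.cast_nonneg (α := ℝ) b)]
    have h2 : (1 + c : ℝ) ^ η ≤ (1 + a) ^ η * (1 + b) ^ η := by
      rw [← Real.mul_rpow (by positivity) (by positivity)]
      exact Real.rpow_le_rpow (by positivity) h1 hη0.le
    rw [Real.rpow_neg (by positivity), Real.rpow_neg (by positivity), ← div_eq_mul_inv,
      le_div_iff₀ (by positivity), inv_mul_le_iff₀ (by positivity)]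
    linarith

/-- The surplus rate `ε` in the first alternative for exponential decay pays for a polynomial
weight, whose sums over the sites are uniformly bounded. -/
lemma exists_exp_le_rpow {ε η : ℝ} (hε : 0 < ε) :
    ∃ c > 0, ∀ r : ℕ, Real.exp (-ε * r) ≤ c * (1 + r : ℝ) ^ (-η) := by
  have h1 : Tendsto (fun r : ℕ => (1 + r : ℝ) ^ η * Real.exp (-ε * (1 + r))) atTop (𝓝 0) :=
    (tendsto_rpow_mul_exp_neg_mul_atTop_nhds_zero η ε hε).comp
      (tendsto_atTop_add_const_left _ 1 tendsto_natCast_atTop_atTop)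
  obtain ⟨c, hc⟩ := h1.bddAbove_range
  have hc' : ∀ r : ℕ, (1 + r : ℝ) ^ η * Real.exp (-ε * (1 + r)) ≤ c := fun r => hc ⟨r, rfl⟩
  have hc0 : 0 < c := lt_of_lt_of_le (by positivity) (hc' 0)
  refine ⟨c * Real.exp ε, by positivity, fun r => ?_⟩
  rw [Real.rpow_neg (by positivity), ← div_eq_mul_inv, le_div_iff₀ (by positivity)]
  have h2 : Real.exp (-ε * r) = Real.exp (-ε * (1 + r)) * Real.exp ε := by
    rw [← Real.exp_add]
    congr 1
    ring
  rw [h2]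
  have := mul_le_mul_of_nonneg_right (hc' r) (Real.exp_pos ε).le
  linarith

lemma IsExpDecaying.exists_isVelocityBound {μ : ℝ} (hμ : IsExpDecaying L h μ) :
    ∃ v > 0, IsVelocityBound L h (fun r => Real.exp (-μ * r)) v := by
  obtain ⟨hμ0, ⟨⟨η, hη, K, hK⟩, l, hl, ε, hε, hb⟩ | ⟨s, hs, hs'⟩⟩ := hμ
  · obtain ⟨c, hc, hcr⟩ := exists_exp_le_rpow (η := η) hε
    -- The hypothesis gives no sign for `K`, whereas the rate `κ` must be positive.
    have hK0 : 0 < max K 1 := lt_max_of_lt_right one_pos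
    refine ⟨2 * (l * (c * max K 1)), by positivity,
      isVelocityBound_of_kernel (exp_neg_mul_antitone hμ0)
      (by simp) (fun r => by positivity) (by positivity) fun n z hz y hy => ?_⟩
    calc _ ≤ ∑ w ∈ (L n).sites, l * (c * (1 + (L n).dist z w : ℝ) ^ (-η)) *
          Real.exp (-μ * (L n).dist z y) := by
          refine Finset.sum_le_sum fun w hw => ?_
          have h1 : (((L n).dist z y : ℕ) : ℝ) ≤ (L n).dist z w + (L n).dist w y := by
            exact_mod_cast (L n).dist_triangle hz hw y
          calc _ ≤ l * Real.exp (-(μ + ε) * (L n).dist z w) *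
                Real.exp (-μ * (L n).dist w y) :=
                mul_le_mul_of_nonneg_right (hb n z hz w hw) (by positivity)
            _ = l * Real.exp (-ε * (L n).dist z w) *
                Real.exp (-μ * ((L n).dist z w + (L n).dist w y)) := by
                rw [mul_assoc, mul_assoc, ← Real.exp_add, ← Real.exp_add]
                congr 2
                ring
            _ ≤ l * Real.exp (-ε * (L n).dist z w) * Real.exp (-μ * (L n).dist z y) := by
                refine mul_le_mul_of_nonneg_left (Real.exp_le_exp.2 ?_) (by positivity)
                nlinarith
            _ ≤ _ := by
                refine mul_le_mul_of_nonneg_right ?_ (by positivity)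
                exact mul_le_mul_of_nonneg_left (hcr _) hl.le
      _ ≤ _ := by
          rw [← Finset.sum_mul, ← Finset.mul_sum, ← Finset.mul_sum]
          refine mul_le_mul_of_nonneg_right ?_ (by positivity)
          exact mul_le_mul_of_nonneg_left (mul_le_mul_of_nonneg_left
            ((hK n z hz).trans (le_max_left _ _)) hc.le) hl.le
  · refine ⟨2 * s, by positivity, isVelocityBound_of_diam (exp_neg_mul_antitone hμ0)
      (by simp) (fun r => by positivity) (g := fun a => Real.exp (μ * a)) ?_ hs hs'⟩
    intro a b c hc
    have : (c : ℝ) ≤ a + b := by exact_mod_cast hc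
    rw [← Real.exp_add]
    refine Real.exp_le_exp.2 ?_
    nlinarith

lemma IsVelocityBound.mono {f : ℕ → ℝ} (hf : ∀ r, 0 ≤ f r) {g : ℕ → ℝ} (hfg : ∀ r, f r ≤ g r)
    {v w : ℝ} (hvw : v ≤ w) (hv0 : 0 ≤ v) (hv : IsVelocityBound L h f v) :
    IsVelocityBound L h g w := by
  obtain ⟨C, hC, H⟩ := hv
  refine ⟨C, hC, fun n X hX Y hY hXne hYne A B hAB hd t => ?_⟩
  refine (H n X hX Y hY hXne hYne A B hAB hd t).trans ?_
  have h1 : Real.exp (v * |t|) ≤ Real.exp (w * |t|) := by gcongr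
  have h2 : 1 ≤ Real.exp (v * |t|) := Real.one_le_exp (by positivity)
  have hn : 0 ≤ C * ‖A‖ * ‖B‖ * X.card * Y.card := by positivity
  exact mul_le_mul (mul_le_mul_of_nonneg_left (hfg _) hn) (by linarith) (by linarith)
    (mul_nonneg hn ((hf _).trans (hfg _)))

/-- A choice of velocities for a family of decay functions: slightly more than the infimum of
the possible velocities. -/
def velocity (L : ℕ → FiniteLattice V) (h : ℕ → Interaction d m) (f : ℝ → ℕ → ℝ) (η : ℝ) : ℝ :=
  sInf {w | 0 ≤ w ∧ IsVelocityBound L h (f η) w} + η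

lemma bddBelow_velocities (f : ℕ → ℝ) : BddBelow {w | 0 ≤ w ∧ IsVelocityBound L h f w} :=
  ⟨0, fun _ hw => hw.1⟩

lemma velocity_pos (f : ℝ → ℕ → ℝ) {η : ℝ} (hη : 0 < η) : 0 < velocity L h f η :=
  add_pos_of_nonneg_of_pos (Real.sInf_nonneg fun _ hw => hw.1) hη

/-- The infimum need not be admissible itself, but the added `η > 0` leaves room for an admissible
velocity below. -/
lemma isVelocityBound_velocity {f : ℝ → ℕ → ℝ} {η : ℝ} (hη : 0 < η) (hf : ∀ r, 0 ≤ f η r)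
    (hex : ∃ v > 0, IsVelocityBound L h (f η) v) :
    IsVelocityBound L h (f η) (velocity L h f η) := by
  obtain ⟨v, hv0, hv⟩ := hex
  obtain ⟨w, hw, hlt⟩ := exists_lt_of_csInf_lt
    (s := {w | 0 ≤ w ∧ IsVelocityBound L h (f η) w}) ⟨v, hv0.le, hv⟩ (lt_add_of_pos_right _ hη)
  exact hw.2.mono hf (fun _ => le_rfl) hlt.le hw.1

/-- Faster decay is a stronger demand, so the set of admissible velocities shrinks and its infimum
does not decrease; the summand `η` makes the growth strict. Admissible velocities must exist at the
larger parameter, since `sInf ∅ = 0` would spoil the comparison. -/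
lemma strictMonoOn_velocity {f : ℝ → ℕ → ℝ} {s : Set ℝ}
    (hex : ∀ η ∈ s, ∃ v > 0, IsVelocityBound L h (f η) v) (hf : ∀ η r, 0 ≤ f η r)
    (hanti : ∀ η η', η ≤ η' → ∀ r, f η' r ≤ f η r) : StrictMonoOn (velocity L h f) s := by
  intro η _ η' hη' hlt
  obtain ⟨v, hv0, hv⟩ := hex η' hη'
  refine add_lt_add_of_le_of_lt ?_ hlt
  exact csInf_le_csInf (bddBelow_velocities _) ⟨v, hv0.le, hv⟩ fun w hw =>
    ⟨hw.1, hw.2.mono (hf η') (hanti η η' hlt.le) le_rfl hw.1⟩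

end Velocity

/-! ### The Gaussian-regularized sign function -/

section Filtering

open MeasureTheory Set

/-- The sine transform of `exp (-α t²) / t`, a smooth approximation of `π / 2` times the sign. -/
def sineTransform (α E : ℝ) : ℝ :=
  ∫ t in Ioi (0 : ℝ), Real.sin (t * E) * (Real.exp (-α * t ^ 2) / t)

lemma integrableOn_gaussian {α : ℝ} (hα : 0 < α) (s : Set ℝ) :
    IntegrableOn (fun t : ℝ => Real.exp (-α * t ^ 2)) s :=
  (integrable_exp_neg_mul_sq hα).integrableOn

lemma norm_sin_mul_gaussian_div_le (α E : ℝ) {t : ℝ} (ht : 0 < t) :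
    ‖Real.sin (t * E) * (Real.exp (-α * t ^ 2) / t)‖ ≤ |E| * Real.exp (-α * t ^ 2) := by
  rw [norm_mul, norm_div, Real.norm_eq_abs, Real.norm_eq_abs, Real.norm_eq_abs, Real.abs_exp,
    abs_of_pos ht]
  have h1 : |Real.sin (t * E)| ≤ t * |E| := by
    refine Real.abs_sin_le_abs.trans_eq ?_
    rw [abs_mul, abs_of_pos ht]
  calc _ ≤ t * |E| * (Real.exp (-α * t ^ 2) / t) := by gcongr
    _ = _ := by field_simp

lemma measurable_sin_mul_gaussian_div (α E : ℝ) :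
    Measurable fun t : ℝ => Real.sin (t * E) * (Real.exp (-α * t ^ 2) / t) := by
  fun_prop

lemma integrableOn_sin_mul_gaussian_div {α : ℝ} (hα : 0 < α) (E : ℝ) :
    IntegrableOn (fun t : ℝ => Real.sin (t * E) * (Real.exp (-α * t ^ 2) / t)) (Ioi 0) := by
  refine Integrable.mono' ((integrableOn_gaussian hα _).const_mul |E|)
    (measurable_sin_mul_gaussian_div α E).aestronglyMeasurable ?_
  filter_upwards [ae_restrict_mem measurableSet_Ioi] with t ht
  exact norm_sin_mul_gaussian_div_le α E ht

/-- Needed for the energies of the sector itself, which are close to `E₀` but not equal to it. The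
inequality `|sin x| ≤ |x|` removes the singularity at `t = 0`. -/
lemma abs_sineTransform_le {α : ℝ} (hα : 0 < α) (E : ℝ) :
    |sineTransform α E| ≤ |E| * Real.sqrt (Real.pi / α) := by
  have h1 : |sineTransform α E| ≤ ∫ t in Ioi (0 : ℝ), |E| * Real.exp (-α * t ^ 2) := by
    rw [← Real.norm_eq_abs]
    refine norm_integral_le_of_norm_le ((integrableOn_gaussian hα _).const_mul |E|) ?_
    filter_upwards [ae_restrict_mem measurableSet_Ioi] with t ht
    exact norm_sin_mul_gaussian_div_le α E ht
  rw [integral_const_mul, integral_gaussian_Ioi] at h1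
  refine h1.trans (mul_le_mul_of_nonneg_left ?_ (abs_nonneg _))
  linarith [Real.sqrt_nonneg (Real.pi / α)]

lemma sineTransform_zero (α : ℝ) : sineTransform α 0 = 0 := by
  simp [sineTransform]

/-- The integrand is even, so the integral is half the real part of the Fourier integral of a
Gaussian. -/
lemma integral_cos_mul_gaussian {α : ℝ} (hα : 0 < α) (E : ℝ) :
    ∫ t in Ioi (0 : ℝ), Real.cos (t * E) * Real.exp (-α * t ^ 2) =
      Real.sqrt (Real.pi / α) / 2 * Real.exp (-(4 * α)⁻¹ * E ^ 2) := by
  have h1 := integral_comp_abs (f := fun t => Real.cos (t * E) * Real.exp (-α * t ^ 2))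
  have h2 : ∀ t : ℝ, Real.cos (|t| * E) * Real.exp (-α * |t| ^ 2) =
      (Complex.exp (Complex.I * E * t) * Complex.exp (-α * t ^ 2)).re := by
    intro t
    have e1 : Real.cos (|t| * E) = Real.cos (t * E) := by
      rcases abs_choice t with h | h <;> rw [h]
      rw [neg_mul, Real.cos_neg]
    have e2 : (-α * t ^ 2 : ℂ) = ((-α * t ^ 2 : ℝ) : ℂ) := by push_cast; ring
    have e3 : (Complex.I * E * t : ℂ) = ((t * E : ℝ) : ℂ) * Complex.I := by push_cast; ring
    rw [e1, sq_abs, e2, e3, ← Complex.ofReal_exp, Complex.re_mul_ofReal,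
      Complex.exp_ofReal_mul_I_re]
  have hint : Integrable fun t : ℝ =>
      Complex.exp (Complex.I * E * t) * Complex.exp (-α * t ^ 2) := by
    refine Integrable.mono' (integrable_exp_neg_mul_sq hα) (by fun_prop) ?_
    filter_upwards with t
    have e2 : (-α * t ^ 2 : ℂ) = ((-α * t ^ 2 : ℝ) : ℂ) := by push_cast; ring
    have e3 : (Complex.I * E * t : ℂ) = ((t * E : ℝ) : ℂ) * Complex.I := by push_cast; ring
    rw [norm_mul, e2, e3, Complex.norm_exp_ofReal_mul_I, one_mul, ← Complex.ofReal_exp,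
      Complex.norm_real, Real.norm_eq_abs, Real.abs_exp]
  have h3 : ∫ t : ℝ, Real.cos (|t| * E) * Real.exp (-α * |t| ^ 2) =
      Real.sqrt (Real.pi / α) * Real.exp (-(4 * α)⁻¹ * E ^ 2) := by
    simp_rw [h2]
    have h4 := integral_re hint
    simp only [RCLike.re_eq_complex_re] at h4
    rw [h4, fourierIntegral_gaussian (by simpa using hα)]
    have e4 : ((Real.pi : ℂ) / α) ^ (1 / 2 : ℂ) = ((Real.sqrt (Real.pi / α) : ℝ) : ℂ) := by
      rw [Real.sqrt_eq_rpow, Complex.ofReal_cpow (by positivity)]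
      push_cast
      rfl
    have e5 : (-(E : ℂ) ^ 2 / (4 * α)) = ((-(4 * α)⁻¹ * E ^ 2 : ℝ) : ℂ) := by
      push_cast
      ring
    rw [e4, e5, ← Complex.ofReal_exp, ← Complex.ofReal_mul, Complex.ofReal_re]
  rw [h3] at h1
  linarith

/-- Differentiation in `E` cancels the factor `1/t`; the sine transform is thereby a primitive of a
Gaussian. -/
lemma hasDerivAt_sineTransform {α : ℝ} (hα : 0 < α) (E : ℝ) :
    HasDerivAt (sineTransform α)
      (Real.sqrt (Real.pi / α) / 2 * Real.exp (-(4 * α)⁻¹ * E ^ 2)) E := by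
  rw [← integral_cos_mul_gaussian hα]
  refine (hasDerivAt_integral_of_dominated_loc_of_deriv_le (s := univ) (x₀ := E)
    (F := fun E t => Real.sin (t * E) * (Real.exp (-α * t ^ 2) / t))
    (F' := fun E t => Real.cos (t * E) * Real.exp (-α * t ^ 2))
    (bound := fun t => Real.exp (-α * t ^ 2)) univ_mem ?_
    (integrableOn_sin_mul_gaussian_div hα E) ?_ ?_ (integrableOn_gaussian hα _) ?_).2
  · filter_upwards with x
    exact (measurable_sin_mul_gaussian_div α x).aestronglyMeasurable
  · exact Continuous.aestronglyMeasurable (by fun_prop)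
  · filter_upwards with t x _
    rw [norm_mul, Real.norm_eq_abs, Real.norm_eq_abs, Real.abs_exp]
    exact mul_le_of_le_one_left (Real.exp_pos _).le (Real.abs_cos_le_one _)
  · filter_upwards [ae_restrict_mem measurableSet_Ioi] with t ht x _
    have ht0 : t ≠ 0 := ne_of_gt ht
    have h1 : HasDerivAt (fun x => Real.sin (t * x)) (Real.cos (t * x) * (t * 1)) x :=
      ((hasDerivAt_id x).const_mul t).sin
    refine (h1.mul_const _).congr_deriv ?_
    field_simp

/-- The transform is the integral over `[0, E]` of a Gaussian whose mass on the half-line is `π/2`,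
so the deviation is its tail. The tail is estimated by `(x + E)² ≥ x² + E²`. -/
lemma abs_sineTransform_sub_le {α : ℝ} (hα : 0 < α) {E : ℝ} (hE : 0 ≤ E) :
    |sineTransform α E - Real.pi / 2| ≤ Real.pi / 2 * Real.exp (-(4 * α)⁻¹ * E ^ 2) := by
  have hb : 0 < (4 * α)⁻¹ := by positivity
  set b := (4 * α)⁻¹ with hbdef
  set c := Real.sqrt (Real.pi / α) / 2 with hc
  have hc0 : 0 ≤ c := by positivity
  have hint : ∀ s, IntegrableOn (fun x : ℝ => Real.exp (-b * x ^ 2)) s :=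
    integrableOn_gaussian hb
  have h1 : ∫ x in (0 : ℝ)..E, c * Real.exp (-b * x ^ 2) = sineTransform α E := by
    rw [intervalIntegral.integral_eq_sub_of_hasDerivAt
      (fun x _ => hasDerivAt_sineTransform hα x), sineTransform_zero, sub_zero]
    exact Continuous.intervalIntegrable (by fun_prop) _ _
  have htot : c * ∫ x in Ioi (0 : ℝ), Real.exp (-b * x ^ 2) = Real.pi / 2 := by
    rw [integral_gaussian_Ioi, hc]
    have : Real.sqrt (Real.pi / α) * Real.sqrt (Real.pi / b) = 2 * Real.pi := by
      rw [← Real.sqrt_mul (by positivity), hbdef]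
      have : Real.pi / α * (Real.pi / (4 * α)⁻¹) = (2 * Real.pi) ^ 2 := by
        field_simp
        ring
      rw [this, Real.sqrt_sq (by positivity)]
    linarith
  have hsplit : ∫ x in Ioi (0 : ℝ), Real.exp (-b * x ^ 2) =
      (∫ x in (0 : ℝ)..E, Real.exp (-b * x ^ 2)) + ∫ x in Ioi E, Real.exp (-b * x ^ 2) := by
    rw [intervalIntegral.integral_of_le hE, ← setIntegral_union
      (Set.Ioc_disjoint_Ioi le_rfl) measurableSet_Ioi (hint _) (hint _),
      Ioc_union_Ioi_eq_Ioi hE]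
  have htail : ∫ x in Ioi E, Real.exp (-b * x ^ 2) ≤
      Real.exp (-b * E ^ 2) * ∫ x in Ioi (0 : ℝ), Real.exp (-b * x ^ 2) := by
    have e1 : ∫ x in Ioi E, Real.exp (-b * x ^ 2) =
        ∫ x in Ioi (0 : ℝ), Real.exp (-b * (x + E) ^ 2) := by
      have := (measurePreserving_add_right volume E).setIntegral_preimage_emb
        (measurableEmbedding_addRight E) (fun x => Real.exp (-b * x ^ 2)) (Ioi E)
      rw [← this]
      simp
    rw [e1, ← integral_const_mul]
    refine setIntegral_mono_on ?_ ((hint _).const_mul _) measurableSet_Ioi fun x hx => ?_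
    · exact ((integrable_exp_neg_mul_sq hb).comp_add_right E).integrableOn
    · rw [← Real.exp_add]
      refine Real.exp_le_exp.2 ?_
      have : 0 ≤ b * (x * E) := by
        have := le_of_lt (mem_Ioi.1 hx)
        positivity
      nlinarith
  have htail0 : 0 ≤ ∫ x in Ioi E, Real.exp (-b * x ^ 2) :=
    integral_nonneg fun x => (Real.exp_pos _).le
  rw [intervalIntegral.integral_const_mul] at h1
  have h2 : sineTransform α E - Real.pi / 2 = -(c * ∫ x in Ioi E, Real.exp (-b * x ^ 2)) := by
    rw [← h1, ← htot, hsplit]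
    ring
  rw [h2, abs_neg, abs_of_nonneg (by positivity), ← htot]
  calc _ ≤ c * (Real.exp (-b * E ^ 2) * ∫ x in Ioi (0 : ℝ), Real.exp (-b * x ^ 2)) :=
        mul_le_mul_of_nonneg_left htail hc0
    _ = _ := by ring

lemma integrableOn_mul_gaussian {α : ℝ} (hα : 0 < α) (s : Set ℝ) :
    IntegrableOn (fun t : ℝ => t * Real.exp (-α * t ^ 2)) s :=
  (integrable_mul_exp_neg_mul_sq hα).integrableOn

lemma integral_Ioi_mul_gaussian {α : ℝ} (hα : 0 < α) (T : ℝ) :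
    ∫ t in Ioi T, t * Real.exp (-α * t ^ 2) = Real.exp (-α * T ^ 2) / (2 * α) := by
  have hd : ∀ t : ℝ, HasDerivAt (fun t => -(Real.exp (-α * t ^ 2) / (2 * α)))
      (t * Real.exp (-α * t ^ 2)) t := by
    intro t
    have h1 : HasDerivAt (fun t : ℝ => Real.exp (-α * t ^ 2))
        (Real.exp (-α * t ^ 2) * (-α * (2 * t))) t := by
      have := ((hasDerivAt_pow 2 t).const_mul (-α)).exp
      simpa using this
    refine (h1.div_const (2 * α)).neg.congr_deriv ?_
    field_simp
  have hlim : Tendsto (fun t : ℝ => -(Real.exp (-α * t ^ 2) / (2 * α))) atTop (𝓝 0) := by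
    have h1 : Tendsto (fun t : ℝ => -α * t ^ 2) atTop atBot :=
      (tendsto_pow_atTop two_ne_zero).const_mul_atTop_of_neg (by linarith)
    simpa using ((Real.tendsto_exp_atBot.comp h1).div_const (2 * α)).neg
  rw [integral_Ioi_of_hasDerivAt_of_tendsto' (fun t _ => hd t) (integrableOn_mul_gaussian hα _)
    hlim]
  ring

/-- The time integral is split at `T`: the growing bound `h1` is used before and the constant bound
`h2` after. The terms `D t` stem from the width of the sector. Finite sums suffice, as the spectrum
is finite, and they commute with the integral. -/
lemma norm_sum_sineTransform_le {ι : Type*} [Fintype ι] {α T : ℝ} (hα : 0 < α) (hT : 0 < T)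
    (e : ι → ℝ) (z : ι → ℂ) {N v P D : ℝ} (hN : 0 ≤ N) (hv : 0 ≤ v) (hP : 0 ≤ P) (hD : 0 ≤ D)
    (h1 : ∀ t, 0 < t → ‖∑ j, ((Real.sin (t * e j) : ℝ) : ℂ) * z j‖ ≤
      N * (Real.exp (v * t) - 1) + D * t)
    (h2 : ∀ t, 0 < t → ‖∑ j, ((Real.sin (t * e j) : ℝ) : ℂ) * z j‖ ≤ P + D * t) :
    ‖∑ j, ((sineTransform α (e j) : ℝ) : ℂ) * z j‖ ≤
      N * Real.exp (v * T) + P * (Real.exp (-α * T ^ 2) / (2 * (α * T ^ 2)))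
        + D * Real.sqrt (Real.pi / α) := by
  set k : ℝ → ℝ := fun t => Real.exp (-α * t ^ 2) / t with hk
  set f : ℝ → ℂ := fun t => ∑ j, ((Real.sin (t * e j) * k t : ℝ) : ℂ) * z j with hf
  have hfi : IntegrableOn f (Ioi 0) := by
    refine integrable_finsetSum _ fun j _ => ?_
    exact (integrableOn_sin_mul_gaussian_div hα (e j)).ofReal.mul_const _
  have hint : ∫ t in Ioi (0 : ℝ), f t = ∑ j, ((sineTransform α (e j) : ℝ) : ℂ) * z j := by
    rw [hf, integral_finsetSum _ fun j _ =>
      (integrableOn_sin_mul_gaussian_div hα (e j)).ofReal.mul_const _]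
    refine Finset.sum_congr rfl fun j _ => ?_
    rw [integral_mul_const, integral_complex_ofReal]
    rfl
  have hnorm : ∀ t, 0 < t → ‖f t‖ =
      ‖∑ j, ((Real.sin (t * e j) : ℝ) : ℂ) * z j‖ * (Real.exp (-α * t ^ 2) / t) := by
    intro t ht
    have e1 : f t = (∑ j, ((Real.sin (t * e j) : ℝ) : ℂ) * z j) * ((k t : ℝ) : ℂ) := by
      rw [hf, Finset.sum_mul]
      refine Finset.sum_congr rfl fun j _ => ?_
      push_cast
      ring
    rw [e1, norm_mul, Complex.norm_real, Real.norm_of_nonneg]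
    exact div_nonneg (Real.exp_pos _).le ht.le
  have hsplit : ∫ t in Ioi (0 : ℝ), f t = (∫ t in Ioc 0 T, f t) + ∫ t in Ioi T, f t := by
    rw [← setIntegral_union (Set.Ioc_disjoint_Ioi le_rfl)
      measurableSet_Ioi (hfi.mono_set Ioc_subset_Ioi_self)
      (hfi.mono_set (Ioi_subset_Ioi hT.le)), Ioc_union_Ioi_eq_Ioi hT.le]
  have hA : ‖∫ t in Ioc 0 T, f t‖ ≤ ∫ t in Ioc 0 T,
      (N * (Real.exp (v * t) * (v * 1)) + D * Real.exp (-α * t ^ 2)) := by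
    refine norm_integral_le_of_norm_le ?_ ?_
    · exact ((Continuous.integrableOn_Icc (by fun_prop)).mono_set Ioc_subset_Icc_self)
    · filter_upwards [ae_restrict_mem measurableSet_Ioc] with t ht
      rw [hnorm t ht.1]
      have ht0 := ht.1
      have he1 : Real.exp (-α * t ^ 2) ≤ 1 := Real.exp_le_one_iff.2 (by nlinarith [sq_nonneg t])
      -- The factor `t` gained here compensates `1/t`; what is left is the derivative of `exp (v
      -- t)`.
      have he2 : Real.exp (v * t) - 1 ≤ v * t * Real.exp (v * t) := by
        have h3 := Real.add_one_le_exp (-(v * t))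
        have h4 : Real.exp (v * t) * Real.exp (-(v * t)) = 1 := by
          rw [← Real.exp_add]; simp
        nlinarith [Real.exp_pos (v * t)]
      have he3 : 0 ≤ v * t * Real.exp (v * t) := by positivity
      calc _ ≤ (N * (v * t * Real.exp (v * t)) + D * t) * (Real.exp (-α * t ^ 2) / t) := by
            refine mul_le_mul_of_nonneg_right ((h1 t ht0).trans ?_) (by positivity)
            gcongr
        _ = N * (v * Real.exp (v * t)) * Real.exp (-α * t ^ 2) + D * Real.exp (-α * t ^ 2) := by
            field_simp
        _ ≤ N * (v * Real.exp (v * t)) * 1 + D * Real.exp (-α * t ^ 2) := by gcongr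
        _ = _ := by ring
  have hB : ‖∫ t in Ioi T, f t‖ ≤ ∫ t in Ioi T,
      (P / T ^ 2 * (t * Real.exp (-α * t ^ 2)) + D * Real.exp (-α * t ^ 2)) := by
    refine norm_integral_le_of_norm_le (((integrableOn_mul_gaussian hα _).const_mul _).add
      ((integrableOn_gaussian hα _).const_mul _)) ?_
    filter_upwards [ae_restrict_mem measurableSet_Ioi] with t ht
    have htT : T < t := ht
    have ht0 : 0 < t := hT.trans htT
    rw [hnorm t ht0]
    -- This makes the Gaussian tail integrable in closed form.
    have h3 : 1 / t ≤ t / T ^ 2 := by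
      rw [div_le_div_iff₀ ht0 (by positivity)]
      nlinarith
    calc _ ≤ (P + D * t) * (Real.exp (-α * t ^ 2) / t) :=
          mul_le_mul_of_nonneg_right (h2 t ht0) (by positivity)
      _ = P * Real.exp (-α * t ^ 2) * (1 / t) + D * Real.exp (-α * t ^ 2) := by field_simp
      _ ≤ P * Real.exp (-α * t ^ 2) * (t / T ^ 2) + D * Real.exp (-α * t ^ 2) := by gcongr
      _ = _ := by ring
  have hA' : ∫ t in Ioc 0 T, N * (Real.exp (v * t) * (v * 1)) ≤ N * Real.exp (v * T) := by
    rw [integral_const_mul, ← intervalIntegral.integral_of_le hT.le,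
      intervalIntegral.integral_eq_sub_of_hasDerivAt (f := fun t => Real.exp (v * t))
        (f' := fun t => Real.exp (v * t) * (v * 1))
        (fun t _ => ((hasDerivAt_id t).const_mul v).exp)
        (Continuous.intervalIntegrable (by fun_prop) _ _)]
    refine mul_le_mul_of_nonneg_left ?_ hN
    linarith [Real.exp_pos (v * 0)]
  have hD' : (∫ t in Ioc 0 T, D * Real.exp (-α * t ^ 2)) + ∫ t in Ioi T,
      D * Real.exp (-α * t ^ 2) ≤ D * Real.sqrt (Real.pi / α) := by
    have hi := fun s => (integrableOn_gaussian hα s).const_mul D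
    rw [← setIntegral_union (Set.Ioc_disjoint_Ioi le_rfl)
      measurableSet_Ioi (hi _) (hi _), Ioc_union_Ioi_eq_Ioi hT.le, integral_const_mul,
      integral_gaussian_Ioi]
    refine mul_le_mul_of_nonneg_left ?_ hD
    linarith [Real.sqrt_nonneg (Real.pi / α)]
  rw [integral_add ((Continuous.integrableOn_Icc (by fun_prop)).mono_set Ioc_subset_Icc_self)
    ((integrableOn_gaussian hα _).const_mul _)] at hA
  rw [integral_add ((integrableOn_mul_gaussian hα _).const_mul _)
    ((integrableOn_gaussian hα _).const_mul _), integral_const_mul,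
    integral_Ioi_mul_gaussian hα] at hB
  have hP' : P / T ^ 2 * (Real.exp (-α * T ^ 2) / (2 * α)) =
      P * (Real.exp (-α * T ^ 2) / (2 * (α * T ^ 2))) := by
    field_simp
  rw [hP'] at hB
  rw [← hint, hsplit]
  refine (norm_add_le _ _).trans ?_
  linarith

end Filtering

/-! ### Functions of a Hermitian matrix in its eigenbasis -/

section SpectralCalculus

variable {n : Type*} [Fintype n]

/-- The quadratic form `⟨Φ, M Φ⟩`. -/
def quadForm (Φ : n → ℂ) (M : Matrix n n ℂ) : ℂ := star Φ ⬝ᵥ (M *ᵥ Φ)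

variable (Φ : n → ℂ)

lemma quadForm_add (M N : Matrix n n ℂ) :
    quadForm Φ (M + N) = quadForm Φ M + quadForm Φ N := by
  simp [quadForm, Matrix.add_mulVec, dotProduct_add]

lemma quadForm_sub (M N : Matrix n n ℂ) :
    quadForm Φ (M - N) = quadForm Φ M - quadForm Φ N := by
  simp [quadForm, Matrix.sub_mulVec, dotProduct_sub]

lemma quadForm_smul (c : ℂ) (M : Matrix n n ℂ) :
    quadForm Φ (c • M) = c * quadForm Φ M := by
  simp [quadForm, Matrix.smul_mulVec, dotProduct_smul]

variable {Φ}

lemma quadForm_mul_of_mulVec_eq {P : Matrix n n ℂ} (hP : P *ᵥ Φ = Φ) (M : Matrix n n ℂ) :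
    quadForm Φ (M * P) = quadForm Φ M := by
  rw [quadForm, ← Matrix.mulVec_mulVec, hP, quadForm]

lemma quadForm_mul_of_mulVec_eq' {P : Matrix n n ℂ} (hP : P *ᵥ Φ = Φ) (hPs : star P = P)
    (M : Matrix n n ℂ) : quadForm Φ (P * M) = quadForm Φ M := by
  rw [quadForm, quadForm, ← Matrix.mulVec_mulVec, Matrix.dotProduct_mulVec]
  congr 1
  conv_lhs => rw [← hPs]
  rw [Matrix.star_eq_conjTranspose, ← Matrix.star_mulVec, hP]

variable [DecidableEq n]

/-- The matrix that is diagonal with entries `g` in the eigenbasis of `H`. -/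
def eigenDiagonal {H : Matrix n n ℂ} (hH : H.IsHermitian) (g : n → ℂ) : Matrix n n ℂ :=
  hH.eigenvectorUnitary * Matrix.diagonal g * star (hH.eigenvectorUnitary : Matrix n n ℂ)

variable {H : Matrix n n ℂ} (hH : H.IsHermitian)

lemma eigenDiagonal_mul (g g' : n → ℂ) :
    eigenDiagonal hH g * eigenDiagonal hH g' = eigenDiagonal hH fun j => g j * g' j := by
  unfold eigenDiagonal
  set U : Matrix n n ℂ := (hH.eigenvectorUnitary : Matrix n n ℂ) with hUdef
  have hU : star U * U = 1 := Unitary.coe_star_mul_self hH.eigenvectorUnitary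
  calc _ = U * Matrix.diagonal g * (star U * U) * Matrix.diagonal g' * star U := by
        simp only [mul_assoc]
    _ = _ := by rw [hU, mul_one, mul_assoc U, Matrix.diagonal_mul_diagonal]

lemma eigenDiagonal_sub (g g' : n → ℂ) :
    eigenDiagonal hH g - eigenDiagonal hH g' = eigenDiagonal hH fun j => g j - g' j := by
  unfold eigenDiagonal
  rw [← Matrix.diagonal_sub, mul_sub, sub_mul]

lemma eigenDiagonal_smul (c : ℂ) (g : n → ℂ) :
    c • eigenDiagonal hH g = eigenDiagonal hH fun j => c * g j := by
  unfold eigenDiagonal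
  have : Matrix.diagonal (fun j => c * g j) = c • Matrix.diagonal g := by
    rw [← Matrix.diagonal_smul]
    rfl
  rw [this, mul_smul_comm, smul_mul_assoc]

lemma eigenDiagonal_one : eigenDiagonal hH (fun _ => 1) = 1 := by
  unfold eigenDiagonal
  rw [Matrix.diagonal_one, mul_one]
  exact Unitary.coe_mul_star_self hH.eigenvectorUnitary

lemma star_eigenDiagonal (g : n → ℂ) :
    star (eigenDiagonal hH g) = eigenDiagonal hH (star g) := by
  unfold eigenDiagonal
  rw [star_mul, star_mul, star_star, Matrix.star_eq_conjTranspose (Matrix.diagonal g),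
    Matrix.diagonal_conjTranspose, mul_assoc]

lemma norm_eigenDiagonal_le (g : n → ℂ) {c : ℝ} (hc : 0 ≤ c) (hg : ∀ j, ‖g j‖ ≤ c) :
    ‖eigenDiagonal hH g‖ ≤ c := by
  unfold eigenDiagonal
  rw [CStarRing.norm_mul_mem_unitary _ (Unitary.star_mem hH.eigenvectorUnitary.2),
    CStarRing.norm_mem_unitary_mul _ hH.eigenvectorUnitary.2, Matrix.l2_opNorm_diagonal]
  exact (pi_norm_le_iff_of_nonneg hc).2 hg

lemma eigenDiagonal_eq_sum (g : n → ℂ) :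
    eigenDiagonal hH g = ∑ j, g j • eigenDiagonal hH (Pi.single j 1) := by
  unfold eigenDiagonal
  have h1 : Matrix.diagonal g = ∑ j, g j • Matrix.diagonal (Pi.single j (1 : ℂ)) := by
    ext i k
    simp only [Matrix.sum_apply, Matrix.smul_apply, Matrix.diagonal_apply, Pi.single_apply]
    by_cases hik : i = k <;> simp [hik]
  rw [h1, Finset.mul_sum, Finset.sum_mul]
  refine Finset.sum_congr rfl fun j _ => ?_
  rw [mul_smul_comm, smul_mul_assoc]

lemma eigenDiagonal_eigenvalues :
    eigenDiagonal hH (fun j => (hH.eigenvalues j : ℂ)) = H := by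
  conv_rhs => rw [hH.spectral_theorem]
  rw [Unitary.conjStarAlgAut_apply]
  rfl

lemma exp_smul_eq_eigenDiagonal (c : ℂ) :
    NormedSpace.exp (c • H) = eigenDiagonal hH fun j => Complex.exp (c * hH.eigenvalues j) := by
  conv_lhs => rw [← eigenDiagonal_eigenvalues hH, eigenDiagonal_smul]
  have h1 := Matrix.exp_units_conj (Unitary.toUnits hH.eigenvectorUnitary)
    (Matrix.diagonal fun j => c * (hH.eigenvalues j : ℂ))
  rw [Matrix.exp_diagonal] at h1
  refine h1.trans ?_
  unfold eigenDiagonal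
  congr 3
  funext j
  rw [Pi.coe_exp, Complex.exp_eq_exp_ℂ]

lemma cfc_eq_eigenDiagonal (f : ℝ → ℝ) :
    cfc f H = eigenDiagonal hH fun j => ((f (hH.eigenvalues j) : ℝ) : ℂ) := by
  rw [hH.cfc_eq, Matrix.IsHermitian.cfc, Unitary.conjStarAlgAut_apply]
  rfl

lemma norm_quadForm_le (hΦ : star Φ ⬝ᵥ Φ = 1) (M : Matrix n n ℂ) : ‖quadForm Φ M‖ ≤ ‖M‖ := by
  have h1 : ‖WithLp.toLp 2 Φ‖ = 1 := by
    have h2 : (‖WithLp.toLp 2 Φ‖ : ℝ) ^ 2 = 1 := by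
      rw [@norm_sq_eq_re_inner ℂ, EuclideanSpace.inner_toLp_toLp, dotProduct_comm, hΦ]
      exact RCLike.one_re
    nlinarith [norm_nonneg (WithLp.toLp 2 Φ)]
  have h3 : quadForm Φ M = inner ℂ (WithLp.toLp 2 Φ) (WithLp.toLp 2 (M *ᵥ Φ)) := by
    rw [EuclideanSpace.inner_toLp_toLp, dotProduct_comm]
    rfl
  rw [h3]
  refine (norm_inner_le_norm _ _).trans ?_
  rw [h1, one_mul]
  have := Matrix.l2_opNorm_mulVec M (WithLp.toLp 2 Φ)
  rw [h1, mul_one] at this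
  exact this

end SpectralCalculus

/-! ### Clustering in a finite volume -/

section FiniteVolume

variable {n : Type*} [Fintype n] [DecidableEq n] {H : Matrix n n ℂ}

lemma norm_exp_mul_I_sub_le (x y : ℝ) :
    ‖Complex.exp (Complex.I * x) - Complex.exp (Complex.I * y)‖ ≤ |x - y| := by
  have h1 : Complex.exp (Complex.I * x) - Complex.exp (Complex.I * y) =
      Complex.exp (Complex.I * y) * (Complex.exp (Complex.I * ((x - y : ℝ) : ℂ)) - 1) := by
    rw [mul_sub, ← Complex.exp_add, mul_one]
    congr 2
    push_cast
    ring
  rw [h1, norm_mul, mul_comm Complex.I (y : ℂ), Complex.norm_exp_ofReal_mul_I, one_mul]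
  exact Real.norm_exp_I_mul_ofReal_sub_one_le

lemma isSelfAdjoint_and_norm_le_cfc_indicator (hH : H.IsHermitian) (S : Set ℝ) :
    star (cfc (S.indicator fun _ => (1 : ℝ)) H) = cfc (S.indicator fun _ => (1 : ℝ)) H ∧
      ‖cfc (S.indicator fun _ => (1 : ℝ)) H‖ ≤ 1 := by
  rw [cfc_eq_eigenDiagonal hH]
  refine ⟨?_, ?_⟩
  · rw [star_eigenDiagonal]
    congr 1
    funext j
    simp
  · refine norm_eigenDiagonal_le hH _ zero_le_one fun j => ?_
    rw [Complex.norm_real]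
    by_cases hj : hH.eigenvalues j ∈ S <;> simp [hj]

/-- The time evolution, acting on the spectral subspace of energies near `E₀`, is close to a
phase. -/
lemma norm_exp_sub_mul_projection_le (hH : H.IsHermitian) {S : Set ℝ} {E₀ δ : ℝ} (hδ : 0 ≤ δ)
    (hS : ∀ E ∈ S, |E - E₀| ≤ δ) (t : ℝ) :
    ‖(NormedSpace.exp ((Complex.I * t) • H) - Complex.exp (Complex.I * ((t * E₀ : ℝ) : ℂ)) • 1) *
      cfc (S.indicator fun _ => (1 : ℝ)) H‖ ≤ |t| * δ := by
  rw [exp_smul_eq_eigenDiagonal hH, cfc_eq_eigenDiagonal hH, ← eigenDiagonal_one hH,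
    eigenDiagonal_smul, eigenDiagonal_sub, eigenDiagonal_mul]
  refine norm_eigenDiagonal_le hH _ (by positivity) fun j => ?_
  by_cases hj : hH.eigenvalues j ∈ S
  · rw [Set.indicator_of_mem hj, Complex.ofReal_one, mul_one, mul_one]
    have h1 : Complex.I * t * (hH.eigenvalues j : ℂ) =
        Complex.I * ((t * hH.eigenvalues j : ℝ) : ℂ) := by
      push_cast
      ring
    rw [h1]
    refine (norm_exp_mul_I_sub_le _ _).trans ?_
    rw [← mul_sub, abs_mul]
    exact mul_le_mul_of_nonneg_left (hS _ hj) (abs_nonneg _)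
  · rw [Set.indicator_of_notMem hj, Complex.ofReal_zero, mul_zero, norm_zero]
    positivity

lemma eigenDiagonal_mul_exp (hH : H.IsHermitian) (c : ℂ) (g : n → ℂ) :
    eigenDiagonal hH g * NormedSpace.exp (c • H) =
      NormedSpace.exp (c • H) * eigenDiagonal hH g := by
  rw [exp_smul_eq_eigenDiagonal hH, eigenDiagonal_mul, eigenDiagonal_mul]
  simp only [mul_comm]

lemma norm_exp_smul_le_one (hH : H.IsHermitian) (t : ℝ) :
    ‖NormedSpace.exp ((Complex.I * t) • H)‖ ≤ 1 := by
  rw [exp_smul_eq_eigenDiagonal hH]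
  refine norm_eigenDiagonal_le hH _ zero_le_one fun j => ?_
  have h1 : Complex.I * t * (hH.eigenvalues j : ℂ) =
      ((t * hH.eigenvalues j : ℝ) : ℂ) * Complex.I := by
    push_cast
    ring
  rw [h1, Complex.norm_exp_ofReal_mul_I]

lemma exp_phase_eq_eigenDiagonal (hH : H.IsHermitian) (t E₀ : ℝ) :
    Complex.exp (Complex.I * ((t * E₀ : ℝ) : ℂ)) • NormedSpace.exp (-(Complex.I * t) • H) =
      eigenDiagonal hH fun j =>
        Complex.exp (-(Complex.I * ((t * (hH.eigenvalues j - E₀) : ℝ) : ℂ))) := by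
  rw [exp_smul_eq_eigenDiagonal hH, eigenDiagonal_smul]
  congr 1
  funext j
  rw [← Complex.exp_add]
  congr 1
  push_cast
  ring

/-- The expectation of the commutator in a state of nearly constant energy. -/
lemma norm_quadForm_lie_sub_le (hH : H.IsHermitian) {S : Set ℝ} {E₀ δ : ℝ} (hδ : 0 ≤ δ)
    (hS : ∀ E ∈ S, |E - E₀| ≤ δ) {Φ : n → ℂ} (hΦ : star Φ ⬝ᵥ Φ = 1)
    (hP : cfc (S.indicator fun _ => (1 : ℝ)) H *ᵥ Φ = Φ) (A B : Matrix n n ℂ) (t : ℝ) :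
    ‖quadForm Φ ⁅conjExp H t A, B⁆ -
      (quadForm Φ (A * eigenDiagonal hH (fun j =>
          Complex.exp (-(Complex.I * ((t * (hH.eigenvalues j - E₀) : ℝ) : ℂ)))) * B) -
        quadForm Φ (B * eigenDiagonal hH (fun j =>
          Complex.exp (-(Complex.I * ((-t * (hH.eigenvalues j - E₀) : ℝ) : ℂ)))) * A))‖ ≤
      2 * |t| * δ * ‖A‖ * ‖B‖ := by
  obtain ⟨hPs, -⟩ := isSelfAdjoint_and_norm_le_cfc_indicator hH S
  have hcom : ∀ c : ℂ, cfc (S.indicator fun _ => (1 : ℝ)) H * NormedSpace.exp (c • H) =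
      NormedSpace.exp (c • H) * cfc (S.indicator fun _ => (1 : ℝ)) H := fun c => by
    rw [cfc_eq_eigenDiagonal hH, eigenDiagonal_mul_exp]
  have hb1 := norm_exp_sub_mul_projection_le hH hδ hS t
  have hb2 := norm_exp_sub_mul_projection_le hH hδ hS (-t)
  set P := cfc (S.indicator fun _ => (1 : ℝ)) H
  rw [← exp_phase_eq_eigenDiagonal, ← exp_phase_eq_eigenDiagonal]
  have hneg : (Complex.I * ((-t : ℝ) : ℂ)) = -(Complex.I * t) := by push_cast; ring
  rw [hneg] at hb2
  rw [hneg, neg_neg]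
  have hn1 := norm_exp_smul_le_one hH t
  have hn2 := norm_exp_smul_le_one hH (-t)
  rw [hneg] at hn2
  set W := NormedSpace.exp ((Complex.I * t) • H) with hW
  set W' := NormedSpace.exp (-(Complex.I * t) • H) with hW'
  set z := Complex.exp (Complex.I * ((t * E₀ : ℝ) : ℂ))
  set z' := Complex.exp (Complex.I * ((-t * E₀ : ℝ) : ℂ))
  have hc1 : P * (W - z • 1) = (W - z • 1) * P := by
    rw [mul_sub, sub_mul, hcom, mul_smul_comm, smul_mul_assoc, mul_one, one_mul]
  -- Since `P` fixes `Φ` and commutes with the evolution, it can be inserted beside the outer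
  -- exponential of each product; there the exponential may be replaced by its phase at energy `E₀`.
  have e1 : quadForm Φ ⁅conjExp H t A, B⁆ - (quadForm Φ (A * (z • W') * B) -
      quadForm Φ (B * (z' • W) * A)) = quadForm Φ ((W - z • 1) * P * (A * W' * B)) -
      quadForm Φ (B * W * A * ((W' - z' • 1) * P)) := by
    rw [← hc1, mul_assoc P, quadForm_mul_of_mulVec_eq' hP hPs, ← mul_assoc (B * W * A),
      quadForm_mul_of_mulVec_eq hP, conjExp, ← hW, ← hW', Ring.lie_def, quadForm_sub]
    have e2 : (W - z • 1) * (A * W' * B) = W * A * W' * B - A * (z • W') * B := by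
      simp only [sub_mul, smul_mul_assoc, mul_smul_comm, one_mul, mul_assoc]
    have e3 : B * W * A * (W' - z' • 1) = B * (W * A * W') - B * (z' • W) * A := by
      simp only [mul_sub, smul_mul_assoc, mul_smul_comm, mul_one, mul_assoc]
    rw [e2, e3, quadForm_sub, quadForm_sub]
    ring
  rw [e1]
  have f1 : ‖(W - z • 1) * P * (A * W' * B)‖ ≤ |t| * δ * (‖A‖ * 1 * ‖B‖) := by
    refine (norm_mul_le _ _).trans (mul_le_mul hb1 ?_ (norm_nonneg _) (by positivity))
    refine (norm_mul_le _ _).trans (mul_le_mul_of_nonneg_right ?_ (norm_nonneg _))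
    exact (norm_mul_le _ _).trans (mul_le_mul_of_nonneg_left hn2 (norm_nonneg _))
  have f2 : ‖B * W * A * ((W' - z' • 1) * P)‖ ≤ ‖B‖ * 1 * ‖A‖ * (|t| * δ) := by
    rw [abs_neg] at hb2
    refine (norm_mul_le _ _).trans (mul_le_mul ?_ hb2 (norm_nonneg _) (by positivity))
    refine (norm_mul_le _ _).trans (mul_le_mul_of_nonneg_right ?_ (norm_nonneg _))
    exact (norm_mul_le _ _).trans (mul_le_mul_of_nonneg_left hn1 (norm_nonneg _))
  calc _ ≤ |t| * δ * (‖A‖ * 1 * ‖B‖) + ‖B‖ * 1 * ‖A‖ * (|t| * δ) :=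
        (norm_sub_le _ _).trans (add_le_add ((norm_quadForm_le hΦ _).trans f1)
          ((norm_quadForm_le hΦ _).trans f2))
    _ = _ := by ring

/-- The symmetrized correlation through the operator with eigenvalues `g`. -/
def symCorrelation (hH : H.IsHermitian) (Φ : n → ℂ) (A B : Matrix n n ℂ) (g : n → ℂ) : ℂ :=
  quadForm Φ (A * eigenDiagonal hH g * B) + quadForm Φ (B * eigenDiagonal hH g * A)

lemma symCorrelation_sub (hH : H.IsHermitian) (Φ : n → ℂ) (A B : Matrix n n ℂ) (g g' : n → ℂ) :
    symCorrelation hH Φ A B (fun j => g j - g' j) =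
      symCorrelation hH Φ A B g - symCorrelation hH Φ A B g' := by
  unfold symCorrelation
  rw [← eigenDiagonal_sub, mul_sub, mul_sub, sub_mul, sub_mul, quadForm_sub, quadForm_sub]
  ring

lemma symCorrelation_smul (hH : H.IsHermitian) (Φ : n → ℂ) (A B : Matrix n n ℂ) (c : ℂ)
    (g : n → ℂ) : symCorrelation hH Φ A B (fun j => c * g j) =
      c * symCorrelation hH Φ A B g := by
  unfold symCorrelation
  rw [← eigenDiagonal_smul]
  simp only [mul_smul_comm, smul_mul_assoc, quadForm_smul]
  ring

/-- Linearity in `g` brings the correlation into the form of a sum over eigenvalues required by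
`norm_sum_sineTransform_le`. -/
lemma symCorrelation_eq_sum (hH : H.IsHermitian) (Φ : n → ℂ) (A B : Matrix n n ℂ) (g : n → ℂ) :
    symCorrelation hH Φ A B g = ∑ j, g j * symCorrelation hH Φ A B (Pi.single j 1) := by
  unfold symCorrelation
  have hsum : ∀ f : n → Matrix n n ℂ, quadForm Φ (∑ j, f j) = ∑ j, quadForm Φ (f j) := by
    intro f
    exact map_sum (AddMonoidHom.mk' (quadForm Φ) (quadForm_add Φ)) f Finset.univ
  rw [eigenDiagonal_eq_sum]
  simp only [Finset.mul_sum, Finset.sum_mul, hsum, mul_smul_comm, smul_mul_assoc, quadForm_smul,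
    mul_add, Finset.sum_add_distrib]

lemma norm_symCorrelation_le (hH : H.IsHermitian) {Φ : n → ℂ} (hΦ : star Φ ⬝ᵥ Φ = 1)
    (A B : Matrix n n ℂ) (g : n → ℂ) {c : ℝ} (hc : 0 ≤ c) (hg : ∀ j, ‖g j‖ ≤ c) :
    ‖symCorrelation hH Φ A B g‖ ≤ 2 * c * ‖A‖ * ‖B‖ := by
  have h : ∀ A B : Matrix n n ℂ, ‖quadForm Φ (A * eigenDiagonal hH g * B)‖ ≤ ‖A‖ * c * ‖B‖ := by
    intro A B
    refine (norm_quadForm_le hΦ _).trans ((norm_mul_le _ _).trans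
      (mul_le_mul_of_nonneg_right ((norm_mul_le _ _).trans
        (mul_le_mul_of_nonneg_left (norm_eigenDiagonal_le hH g hc hg) (norm_nonneg _)))
        (norm_nonneg _)))
  calc _ ≤ ‖A‖ * c * ‖B‖ + ‖B‖ * c * ‖A‖ := (norm_add_le _ _).trans (add_le_add (h A B) (h B A))
    _ = _ := by ring

/-- In the difference of the commutators at `-t` and `t` the exponentials combine to `2i sin`, with
the same sign in both operator orders. This is where the symmetrization originates. -/
lemma norm_symCorrelation_sin_le (hH : H.IsHermitian) {S : Set ℝ} {E₀ δ : ℝ} (hδ : 0 ≤ δ)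
    (hS : ∀ E ∈ S, |E - E₀| ≤ δ) {Φ : n → ℂ} (hΦ : star Φ ⬝ᵥ Φ = 1)
    (hP : cfc (S.indicator fun _ => (1 : ℝ)) H *ᵥ Φ = Φ) (A B : Matrix n n ℂ) {t N : ℝ}
    (ht : 0 < t) (h1 : ‖⁅conjExp H t A, B⁆‖ ≤ N) (h2 : ‖⁅conjExp H (-t) A, B⁆‖ ≤ N) :
    ‖symCorrelation hH Φ A B
      (fun j => ((Real.sin (t * (hH.eigenvalues j - E₀)) : ℝ) : ℂ))‖ ≤
      N + 2 * δ * ‖A‖ * ‖B‖ * t := by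
  have k1 := norm_quadForm_lie_sub_le hH hδ hS hΦ hP A B t
  have k2 := norm_quadForm_lie_sub_le hH hδ hS hΦ hP A B (-t)
  rw [neg_neg] at k2
  set D : ℝ → Matrix n n ℂ := fun t => eigenDiagonal hH fun j =>
    Complex.exp (-(Complex.I * ((t * (hH.eigenvalues j - E₀) : ℝ) : ℂ))) with hD
  have hsin : symCorrelation hH Φ A B
      (fun j => (2 * Complex.I) * ((Real.sin (t * (hH.eigenvalues j - E₀)) : ℝ) : ℂ)) =
      (quadForm Φ (A * D (-t) * B) - quadForm Φ (B * D t * A)) -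
        (quadForm Φ (A * D t * B) - quadForm Φ (B * D (-t) * A)) := by
    have e1 : eigenDiagonal hH (fun j =>
        (2 * Complex.I) * ((Real.sin (t * (hH.eigenvalues j - E₀)) : ℝ) : ℂ)) = D (-t) - D t := by
      rw [hD, eigenDiagonal_sub]
      congr 1
      funext j
      rw [Complex.ofReal_sin, Complex.sin]
      have : ∀ x : ℝ, -(Complex.I * ((-t * x : ℝ) : ℂ)) = ((t * x : ℝ) : ℂ) * Complex.I := by
        intro x
        push_cast
        ring
      rw [this]
      have : ∀ x : ℝ, -(Complex.I * ((t * x : ℝ) : ℂ)) = -((t * x : ℝ) : ℂ) * Complex.I := by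
        intro x
        push_cast
        ring
      rw [this]
      linear_combination (Complex.exp (-((t * (hH.eigenvalues j - E₀) : ℝ) : ℂ) * Complex.I) -
        Complex.exp (((t * (hH.eigenvalues j - E₀) : ℝ) : ℂ) * Complex.I)) * Complex.I_sq
    unfold symCorrelation
    rw [e1, mul_sub, mul_sub, sub_mul, sub_mul, quadForm_sub, quadForm_sub]
    ring
  rw [symCorrelation_smul] at hsin
  have hnorm : 2 * ‖symCorrelation hH Φ A B
      (fun j => ((Real.sin (t * (hH.eigenvalues j - E₀)) : ℝ) : ℂ))‖ ≤
      2 * (N + 2 * δ * ‖A‖ * ‖B‖ * t) := by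
    have : ‖(2 * Complex.I : ℂ)‖ = 2 := by simp
    rw [← this, ← norm_mul, hsin, this]
    have l1 := (norm_quadForm_le hΦ ⁅conjExp H t A, B⁆).trans h1
    have l2 := (norm_quadForm_le hΦ ⁅conjExp H (-t) A, B⁆).trans h2
    rw [abs_neg] at k2
    rw [abs_of_pos ht] at k1 k2
    set q1 := quadForm Φ ⁅conjExp H t A, B⁆
    set q2 := quadForm Φ ⁅conjExp H (-t) A, B⁆
    set r1 := quadForm Φ (A * D t * B) - quadForm Φ (B * D (-t) * A)
    set r2 := quadForm Φ (A * D (-t) * B) - quadForm Φ (B * D t * A)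
    have e : r2 - r1 = (q2 - q1) + ((q1 - r1) - (q2 - r2)) := by ring
    rw [e]
    have t1 := norm_add_le (q2 - q1) ((q1 - r1) - (q2 - r2))
    have t2 := norm_sub_le q2 q1
    have t3 := norm_sub_le (q1 - r1) (q2 - r2)
    linarith
  linarith

/-- Clustering in a finite volume, from a bound on the commutators. -/
lemma norm_quadForm_mul_sub_le (hH : H.IsHermitian) {S : Set ℝ} {E₀ δ ΔE : ℝ} (hδ : 0 ≤ δ)
    (hΔ : 0 < ΔE) (hS : ∀ E ∈ S, |E - E₀| ≤ δ) (hgap : ∀ E ∈ spectrum ℝ H \ S, E₀ + ΔE ≤ E)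
    {Φ : n → ℂ} (hΦ : star Φ ⬝ᵥ Φ = 1)
    (hP : cfc (S.indicator fun _ => (1 : ℝ)) H *ᵥ Φ = Φ) {A B : Matrix n n ℂ}
    (hAB : Commute A B) {N v : ℝ} (hN : 0 ≤ N) (hv : 0 ≤ v)
    (hLR : ∀ t : ℝ, ‖⁅conjExp H t A, B⁆‖ ≤ N * (Real.exp (v * |t|) - 1)) {α T : ℝ} (hα : 0 < α)
    (hT : 0 < T) :
    ‖quadForm Φ (A * B) - (1 / 2) *
        (quadForm Φ (A * cfc (S.indicator fun _ => (1 : ℝ)) H * B) +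
          quadForm Φ (B * cfc (S.indicator fun _ => (1 : ℝ)) H * A))‖ ≤
      N * Real.exp (v * T) + ‖A‖ * ‖B‖ * (Real.exp (-α * T ^ 2) / (α * T ^ 2)) +
        ‖A‖ * ‖B‖ * Real.exp (-(4 * α)⁻¹ * ΔE ^ 2) +
        4 * δ * ‖A‖ * ‖B‖ * Real.sqrt (Real.pi / α) := by
  set e : n → ℝ := fun j => hH.eigenvalues j - E₀ with he
  have hnA := norm_nonneg A
  have hnB := norm_nonneg B
  have hLie : ∀ t : ℝ, ‖⁅conjExp H t A, B⁆‖ ≤ 2 * ‖A‖ * ‖B‖ := fun t =>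
    (norm_lie_le_two_mul _ _).trans_eq (by rw [norm_conjExp hH])
  have hG := norm_sum_sineTransform_le hα hT e
    (fun j => symCorrelation hH Φ A B (Pi.single j 1)) (D := 2 * δ * ‖A‖ * ‖B‖)
    (P := 2 * ‖A‖ * ‖B‖) hN hv
    (by positivity) (by positivity)
    (fun t ht => by
      rw [← symCorrelation_eq_sum hH Φ A B fun j => ((Real.sin (t * e j) : ℝ) : ℂ)]
      refine norm_symCorrelation_sin_le hH hδ hS hΦ hP A B ht ?_ ?_
      · simpa [abs_of_pos ht] using hLR t
      · simpa [abs_of_pos ht] using hLR (-t))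
    (fun t ht => by
      rw [← symCorrelation_eq_sum hH Φ A B fun j => ((Real.sin (t * e j) : ℝ) : ℂ)]
      exact norm_symCorrelation_sin_le hH hδ hS hΦ hP A B ht (hLie t) (hLie (-t)))
  rw [← symCorrelation_eq_sum hH Φ A B fun j => ((sineTransform α (e j) : ℝ) : ℂ)] at hG
  set s : n → ℂ := fun j => ((S.indicator (fun _ => (1 : ℝ)) (hH.eigenvalues j) : ℝ) : ℂ) with hs
  -- Comparison of `(π/2)(1 - P₀)` with the filtered operator, eigenvalue by eigenvalue: on `S` the
  -- transform is of order `δ`, off `S` the gap puts it near `π/2`.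
  have hsub := norm_symCorrelation_le hH hΦ A B
    (fun j => ((Real.pi / 2 : ℝ) : ℂ) * (1 - s j) - ((sineTransform α (e j) : ℝ) : ℂ))
    (c := Real.pi / 2 * Real.exp (-(4 * α)⁻¹ * ΔE ^ 2) + δ * Real.sqrt (Real.pi / α))
    (by positivity) (fun j => by
      by_cases hj : hH.eigenvalues j ∈ S
      · have h1 : s j = 1 := by simp [hs, hj]
        rw [h1, sub_self, mul_zero, zero_sub, norm_neg, Complex.norm_real, Real.norm_eq_abs]
        have h2 := abs_sineTransform_le hα (e j)
        have h3 : |e j| ≤ δ := hS _ hj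
        have h4 : |e j| * Real.sqrt (Real.pi / α) ≤ δ * Real.sqrt (Real.pi / α) := by gcongr
        have h5 : 0 ≤ Real.pi / 2 * Real.exp (-(4 * α)⁻¹ * ΔE ^ 2) := by positivity
        linarith
      · have h1 : s j = 0 := by simp [hs, hj]
        rw [h1, sub_zero, mul_one, ← Complex.ofReal_sub, Complex.norm_real, Real.norm_eq_abs,
          abs_sub_comm]
        have h3 : ΔE ≤ e j := by
          have := hgap _ ⟨hH.eigenvalues_mem_spectrum_real j, hj⟩
          simp only [he]
          linarith
        have h2 := abs_sineTransform_sub_le hα (hΔ.le.trans h3)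
        have h4 : Real.pi / 2 * Real.exp (-(4 * α)⁻¹ * e j ^ 2) ≤
            Real.pi / 2 * Real.exp (-(4 * α)⁻¹ * ΔE ^ 2) := by
          refine mul_le_mul_of_nonneg_left (Real.exp_le_exp.2 ?_) (by positivity)
          have h6 : ΔE ^ 2 ≤ e j ^ 2 := by gcongr
          have h7 : 0 ≤ (4 * α)⁻¹ := by positivity
          nlinarith
        have h5 : 0 ≤ δ * Real.sqrt (Real.pi / α) := by positivity
        linarith)
  rw [symCorrelation_sub, symCorrelation_smul, symCorrelation_sub] at hsub
  have hone : symCorrelation hH Φ A B (fun _ => 1) = 2 * quadForm Φ (A * B) := by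
    unfold symCorrelation
    rw [eigenDiagonal_one, mul_one, mul_one, hAB.eq]
    ring
  have hproj : symCorrelation hH Φ A B s =
      quadForm Φ (A * cfc (S.indicator fun _ => (1 : ℝ)) H * B) +
          quadForm Φ (B * cfc (S.indicator fun _ => (1 : ℝ)) H * A) := by
    rw [symCorrelation, cfc_eq_eigenDiagonal hH]
  rw [hone, hproj] at hsub
  set p := quadForm Φ (A * cfc (S.indicator fun _ => (1 : ℝ)) H * B) +
          quadForm Φ (B * cfc (S.indicator fun _ => (1 : ℝ)) H * A)
  set g := symCorrelation hH Φ A B fun j => ((sineTransform α (e j) : ℝ) : ℂ)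
  have e1 : ((Real.pi / 2 : ℝ) : ℂ) * (2 * quadForm Φ (A * B) - p) =
      ((Real.pi : ℝ) : ℂ) * (quadForm Φ (A * B) - (1 / 2) * p) := by
    push_cast
    ring
  rw [e1] at hsub
  have hfin : Real.pi * ‖quadForm Φ (A * B) - (1 / 2) * p‖ ≤
      ‖((Real.pi : ℝ) : ℂ) * (quadForm Φ (A * B) - (1 / 2) * p) - g‖ + ‖g‖ := by
    have := norm_add_le (((Real.pi : ℝ) : ℂ) * (quadForm Φ (A * B) - (1 / 2) * p) - g) g
    rwa [sub_add_cancel, norm_mul, Complex.norm_real, Real.norm_of_nonneg Real.pi_pos.le] at this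
  -- Only the gap term carries a factor `π`; in the others the division by `π` is simply given away.
  have hpi : (1 : ℝ) ≤ Real.pi := by linarith [Real.pi_gt_three]
  refine le_of_mul_le_mul_left (hfin.trans ((add_le_add hsub hG).trans ?_)) Real.pi_pos
  have a1 : 0 ≤ N * Real.exp (v * T) := by positivity
  have a2 : 0 ≤ ‖A‖ * ‖B‖ * (Real.exp (-α * T ^ 2) / (α * T ^ 2)) := by positivity
  have a3 : 0 ≤ 4 * δ * ‖A‖ * ‖B‖ * Real.sqrt (Real.pi / α) := by positivity
  have a4 : 2 * ‖A‖ * ‖B‖ * (Real.exp (-α * T ^ 2) / (2 * (α * T ^ 2))) =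
      ‖A‖ * ‖B‖ * (Real.exp (-α * T ^ 2) / (α * T ^ 2)) := by
    field_simp
  rw [a4]
  nlinarith [mul_le_mul_of_nonneg_right hpi a1, mul_le_mul_of_nonneg_right hpi a2,
    mul_le_mul_of_nonneg_right hpi a3]

end FiniteVolume

/-! ### Infinite volume and the choice of the filter -/

section Clustering

/-- A lower limit controls only strictly smaller values; because distances are integers, exceeding
the predecessor of `r` is enough. -/
lemma eventually_le_setDist {V : Type*} {L : ℕ → FiniteLattice V} {X Y : Finset V} {r : ℕ} (hr : (r : ℕ∞) ≤ limDist L X Y) :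
    ∀ᶠ n in atTop, r ≤ (L n).setDist X Y := by
  rcases r with _ | r
  · simp
  · have h1 : (r : ℕ∞) < limDist L X Y := lt_of_lt_of_le (by exact_mod_cast r.lt_succ_self) hr
    filter_upwards [eventually_lt_of_lt_liminf h1] with n hn
    exact_mod_cast hn

variable {V : Type*} {d m : V → ℕ} [LinearOrder V] {L : ℕ → FiniteLattice V}
  {h : ℕ → Interaction d m}

lemma isHermitian_hamiltonian (Λ : Finset V) (h : Interaction d m) :
    (hamiltonian Λ h).IsHermitian := by
  have h1 : star (hamiltonian Λ h) = hamiltonian Λ h := by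
    rw [hamiltonian, star_sum]
    refine Finset.sum_congr rfl fun X _ => ?_
    rw [← embed_star]
    exact congrArg _ (h.selfAdjoint X)
  exact h1

lemma norm_expect_mul_le {Λ : Finset V} {Φ : Config d m Λ → ℂ} (hΦ : star Φ ⬝ᵥ Φ = 1)
    (A B : LocalOp d m Λ) {P : LocalOp d m Λ} (hP : ‖P‖ ≤ 1) :
    ‖expect Φ (A * P * B)‖ ≤ ‖A‖ * ‖B‖ := by
  refine (norm_quadForm_le hΦ _).trans ?_
  refine (norm_mul_le _ _).trans (mul_le_mul_of_nonneg_right ?_ (norm_nonneg _))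
  exact (norm_mul_le _ _).trans (mul_le_of_le_one_right (norm_nonneg _) hP)

/-- Finiteness of the spectrum ensures boundedness, without which `Metric.diam` would take a default
value. -/
lemma UniformGap.abs_sub_le {S : ℕ → Set ℝ} {ΔE : ℝ} (hS : UniformGap L h S ΔE) (n : ℕ)
    {E E' : ℝ} (hE : E ∈ S n) (hE' : E' ∈ S n) : |E - E'| ≤ Metric.diam (S n) := by
  have hfin : (S n).Finite := by
    refine Set.Finite.subset ?_ (hS.subset_spectrum n)
    rw [(isHermitian_hamiltonian (L n).sites (h n)).spectrum_real_eq_range_eigenvalues]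
    exact Set.finite_range _
  exact Metric.dist_le_diam_of_mem hfin.isBounded hE hE'

/-- A velocity bound and a gap imply clustering. -/
theorem IsVelocityBound.bosonicClustering (hL : Tendsto (fun n => (L n).sites) atTop atTop)
    {F : ℕ → ℝ} (hF : Monotone F) (hF0 : F 0 = 0) (hF1 : 0 < F 1) {v : ℝ} (hv : 0 < v)
    (hvel : IsVelocityBound L h (fun r => Real.exp (-F r)) v) {ΔE : ℝ} (hΔ : 0 < ΔE) :
    BosonicClustering L h ΔE fun r => Real.exp (-(F r / (1 + 2 * v / ΔE))) := by
  obtain ⟨C, hC, hLR⟩ := hvel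
  set θ := 1 + 2 * v / ΔE with hθ
  have hθ0 : 0 < θ := by positivity
  have hκ1 : 0 < F 1 / θ := by positivity
  -- The summands cover, in order, the short times, the long times (through `1/κ ≤ (F 1 / θ)⁻¹`),
  -- the filter error above the gap, and the trivial bound used for `r = 0`.
  refine ⟨C + (F 1 / θ)⁻¹ + 1 + 2, by positivity, ?_⟩
  intro S hS ω ωP hω X Y hX hY A B hAB r hr
  obtain ⟨k, hk, Φ, hΦ, hPΦ, hlim, hlimP⟩ := hω
  have hcX : (1 : ℝ) ≤ X.card := by exact_mod_cast hX.card_pos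
  have hcY : (1 : ℝ) ≤ Y.card := by exact_mod_cast hY.card_pos
  have hcXY : (1 : ℝ) ≤ X.card * Y.card := one_le_mul_of_one_le_of_one_le hcX hcY
  have hAB0 : 0 ≤ ‖A‖ * ‖B‖ := by positivity
  have hT1 := hlim (X ∪ Y) (prodOp A B)
  have hT := hT1.sub (((hlimP X Y A B).add (hlimP Y X B A)).const_mul (1 / 2 : ℂ))
  have hembA : ∀ Z : Finset V, ‖embed Z A‖ ≤ ‖A‖ := fun Z => norm_embed_le Z A
  have hembB : ∀ Z : Finset V, ‖embed Z B‖ ≤ ‖B‖ := fun Z => norm_embed_le Z B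
  have hsub : ∀ Z : Finset V, ∀ᶠ j in atTop, Z ⊆ (L (k j)).sites := fun Z =>
    hk.tendsto_atTop.eventually (hL.eventually (eventually_ge_atTop Z))
  have hembAB : ∀ Z : Finset V, ‖embed Z A‖ * ‖embed Z B‖ ≤ ‖A‖ * ‖B‖ := fun Z =>
    mul_le_mul (hembA Z) (hembB Z) (norm_nonneg _) (norm_nonneg _)
  rcases Nat.eq_zero_or_pos r with rfl | hr0
  · have hbound : ‖ω (prodOp A B) - (1 / 2) * (ωP A B + ωP B A)‖ ≤ 2 * (‖A‖ * ‖B‖) := by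
      refine le_of_tendsto hT.norm (Eventually.of_forall fun j => ?_)
      have hP := (isSelfAdjoint_and_norm_le_cfc_indicator (isHermitian_hamiltonian (L (k j)).sites (h (k j)))
        (S (k j))).2
      have b1 : ‖expect (Φ (k j)) (embed (L (k j)).sites (prodOp A B))‖ ≤ ‖A‖ * ‖B‖ :=
        (norm_quadForm_le (hΦ _) _).trans ((norm_embed_le _ _).trans (norm_prodOp_le A B))
      have b2 := (norm_expect_mul_le (hΦ (k j)) (embed (L (k j)).sites A)
        (embed (L (k j)).sites B) hP).trans (hembAB _)
      have b3 := (norm_expect_mul_le (hΦ (k j)) (embed (L (k j)).sites B)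
        (embed (L (k j)).sites A) hP).trans ((mul_comm _ _).trans_le (hembAB _))
      refine (norm_sub_le _ _).trans ?_
      rw [norm_mul]
      have b4 := (norm_add_le _ _).trans (add_le_add b2 b3)
      have b5 : ‖(1 / 2 : ℂ)‖ = 1 / 2 := by norm_num
      rw [b5]
      unfold spectralProj
      linarith
    refine hbound.trans ?_
    simp only [hF0, zero_div, neg_zero, Real.exp_zero, mul_one]
    have c1 : 2 * (‖A‖ * ‖B‖) ≤ (C + (F 1 / θ)⁻¹ + 1 + 2) * (‖A‖ * ‖B‖) := by
      refine mul_le_mul_of_nonneg_right ?_ hAB0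
      have : 0 < (F 1 / θ)⁻¹ := by positivity
      linarith
    calc _ ≤ (C + (F 1 / θ)⁻¹ + 1 + 2) * (‖A‖ * ‖B‖) * 1 := by linarith
      _ ≤ (C + (F 1 / θ)⁻¹ + 1 + 2) * (‖A‖ * ‖B‖) * (X.card * Y.card) :=
          mul_le_mul_of_nonneg_left hcXY (by positivity)
      _ = _ := by ring
  · set κ := F r / θ with hκdef
    have hκ1κ : F 1 / θ ≤ κ := div_le_div_of_nonneg_right (hF hr0) hθ0.le
    have hκ : 0 < κ := hκ1.trans_le hκ1κ
    -- The parameters solve `α T² = ΔE² / (4α) = F r - v T = κ`, so all three errors decay like `exp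
    -- (-κ)`; the last equation forces `κ = F r / (1 + 2v/ΔE)`.
    set α := ΔE ^ 2 / (4 * κ) with hαdef
    set T := 2 * κ / ΔE with hTdef
    have hα : 0 < α := by positivity
    have hT0 : 0 < T := by positivity
    have e1 : α * T ^ 2 = κ := by
      rw [hαdef, hTdef]
      field_simp
      ring
    have e2 : -(4 * α)⁻¹ * ΔE ^ 2 = -κ := by
      rw [hαdef]
      field_simp
    have e3 : -F r + v * T = -κ := by
      have : F r = κ * θ := by
        rw [hκdef]
        field_simp
      rw [this, hTdef, hθ]
      field_simp
      ring
    set N := C * ‖A‖ * ‖B‖ * X.card * Y.card * Real.exp (-F r) with hN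
    have hN0 : 0 ≤ N := by positivity
    -- With `α` and `T` fixed by `r` alone, the volume enters only through the width of the sector,
    -- which tends to zero.
    have hdiam : Tendsto (fun j => N * Real.exp (v * T) +
        ‖A‖ * ‖B‖ * (Real.exp (-κ) / κ) + ‖A‖ * ‖B‖ * Real.exp (-κ) +
        4 * Metric.diam (S (k j)) * (‖A‖ * ‖B‖) * Real.sqrt (Real.pi / α)) atTop
        (𝓝 (N * Real.exp (v * T) + ‖A‖ * ‖B‖ * (Real.exp (-κ) / κ) +
          ‖A‖ * ‖B‖ * Real.exp (-κ) + 4 * 0 * (‖A‖ * ‖B‖) * Real.sqrt (Real.pi / α))) :=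
      ((((hS.width.comp hk.tendsto_atTop).const_mul 4).mul_const _).mul_const _).const_add _
    have hbound := le_of_tendsto_of_tendsto hT.norm hdiam (by
      filter_upwards [hsub X, hsub Y, hk.tendsto_atTop.eventually (eventually_le_setDist hr)]
        with j hXj hYj hrj
      have hpos : 0 < (L (k j)).setDist X Y := lt_of_lt_of_le hr0 hrj
      have hdis := (L (k j)).disjoint_of_setDist_pos hpos
      obtain ⟨E₀, hE₀⟩ := hS.nonempty (k j)
      have hLRj : ∀ t : ℝ, ‖⁅conjExp (hamiltonian (L (k j)).sites (h (k j)))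
          t (embed (L (k j)).sites A), embed (L (k j)).sites B⁆‖ ≤
          N * (Real.exp (v * |t|) - 1) := by
        intro t
        refine (hLR (k j) X hXj Y hYj hX hY A B hAB hpos t).trans ?_
        refine mul_le_mul_of_nonneg_right ?_ (sub_nonneg.2 (Real.one_le_exp (by positivity)))
        refine mul_le_mul_of_nonneg_left (Real.exp_le_exp.2 ?_) (by positivity)
        exact neg_le_neg (hF hrj)
      have main := norm_quadForm_mul_sub_le (isHermitian_hamiltonian (L (k j)).sites (h (k j)))
        (S := S (k j)) (δ := Metric.diam (S (k j))) Metric.diam_nonneg hΔ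
        (fun E hE => hS.abs_sub_le (k j) hE hE₀) (fun E hE => hS.gap (k j) E₀ hE₀ E hE)
        (hΦ (k j)) (hPΦ (k j)) (hAB.commute_embed hXj hYj hdis) hN0 hv.le hLRj hα hT0
      rw [neg_mul α, e1, e2] at main
      have hprod := embed_prodOp hXj hYj A B
      rw [hprod]
      refine main.trans ?_
      have hZ := hembAB (L (k j)).sites
      have g1 : ‖embed (L (k j)).sites A‖ * ‖embed (L (k j)).sites B‖ * (Real.exp (-κ) / κ) ≤
          ‖A‖ * ‖B‖ * (Real.exp (-κ) / κ) := mul_le_mul_of_nonneg_right hZ (by positivity)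
      have g2 : ‖embed (L (k j)).sites A‖ * ‖embed (L (k j)).sites B‖ * Real.exp (-κ) ≤
          ‖A‖ * ‖B‖ * Real.exp (-κ) := mul_le_mul_of_nonneg_right hZ (by positivity)
      have hd0 : 0 ≤ 4 * Metric.diam (S (k j)) := by
        have := Metric.diam_nonneg (s := S (k j))
        linarith
      have g3 : 4 * Metric.diam (S (k j)) * ‖embed (L (k j)).sites A‖ *
          ‖embed (L (k j)).sites B‖ * Real.sqrt (Real.pi / α) ≤
          4 * Metric.diam (S (k j)) * (‖A‖ * ‖B‖) * Real.sqrt (Real.pi / α) := by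
        rw [mul_assoc (4 * Metric.diam (S (k j)))]
        exact mul_le_mul_of_nonneg_right (mul_le_mul_of_nonneg_left hZ hd0) (Real.sqrt_nonneg _)
      linarith)
    refine hbound.trans ?_
    have e4 : N * Real.exp (v * T) =
        C * (‖A‖ * ‖B‖ * (X.card * Y.card) * Real.exp (-κ)) := by
      rw [hN, mul_assoc _ (Real.exp (-F r)), ← Real.exp_add, e3]
      ring
    rw [e4]
    set Q := ‖A‖ * ‖B‖ * (X.card * Y.card) * Real.exp (-κ) with hQ
    have hQ0 : 0 ≤ Q := by positivity
    have q1 : ‖A‖ * ‖B‖ * Real.exp (-κ) ≤ Q := by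
      rw [hQ]
      refine mul_le_mul_of_nonneg_right ?_ (Real.exp_pos _).le
      exact le_mul_of_one_le_right hAB0 hcXY
    have q2 : ‖A‖ * ‖B‖ * (Real.exp (-κ) / κ) ≤ (F 1 / θ)⁻¹ * Q := by
      have : κ⁻¹ ≤ (F 1 / θ)⁻¹ := inv_anti₀ hκ1 hκ1κ
      calc _ = κ⁻¹ * (‖A‖ * ‖B‖ * Real.exp (-κ)) := by
            rw [div_eq_mul_inv]
            ring
        _ ≤ _ := mul_le_mul this q1 (by positivity) (by positivity)
    calc _ ≤ C * Q + (F 1 / θ)⁻¹ * Q + Q := by linarith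
      _ ≤ (C + (F 1 / θ)⁻¹ + 1 + 2) * Q := by linarith
      _ = _ := by rw [hQ]; ring

lemma one_add_rpow_neg (r : ℕ) (η : ℝ) :
    (1 + r : ℝ) ^ (-η) = Real.exp (-(η * Real.log (1 + r))) := by
  rw [Real.rpow_def_of_pos (by positivity)]
  congr 1
  ring

end Clustering

end LatticeSystem

end

theorem mainTheorem2 {V : Type*} [LinearOrder V] (d m : V → ℕ)
    (L : ℕ → FiniteLattice V) (hL : Tendsto (fun n => (L n).sites) atTop atTop)
    (h : ℕ → Interaction d m) :
    (∃ v : ℝ → ℝ, StrictMonoOn v {η | IsPowerLaw L h η} ∧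
      ∀ η, IsPowerLaw L h η →
        0 < v η ∧
        IsVelocityBound L h (fun r => (1 + r : ℝ) ^ (-η)) (v η) ∧
        ∀ ΔE > 0,
          BosonicClustering L h ΔE (fun r => (1 + r : ℝ) ^ (-(η / (1 + 2 * v η / ΔE))))) ∧
    (∃ v : ℝ → ℝ, StrictMonoOn v {μ | IsExpDecaying L h μ} ∧
      ∀ μ, IsExpDecaying L h μ →
        0 < v μ ∧
        IsVelocityBound L h (fun r => Real.exp (-μ * r)) (v μ) ∧
        ∀ ΔE > 0,
          BosonicClustering L h ΔE (fun r => Real.exp (-(μ / (1 + 2 * v μ / ΔE)) * r))) := by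
  refine ⟨⟨velocity L h fun η r => (1 + r : ℝ) ^ (-η), ?_, fun η hη => ?_⟩,
    ⟨velocity L h fun μ r => Real.exp (-μ * r), ?_, fun μ hμ => ?_⟩⟩
  · refine strictMonoOn_velocity (fun η hη => IsPowerLaw.exists_isVelocityBound hη)
      (fun η r => by positivity) fun η η' hle r => ?_
    exact Real.rpow_le_rpow_of_exponent_le (by simp) (by linarith)
  · have hvel := isVelocityBound_velocity (f := fun η r => (1 + r : ℝ) ^ (-η)) hη.1
      (fun r => by positivity) hη.exists_isVelocityBound
    have hpos := velocity_pos (L := L) (h := h) (fun η r => (1 + r : ℝ) ^ (-η)) hη.1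
    refine ⟨hpos, hvel, fun ΔE hΔ => ?_⟩
    set v := velocity L h (fun η r => (1 + r : ℝ) ^ (-η)) η
    -- The power law is the case `F r = η log (1 + r)` of the general clustering bound.
    simp only [one_add_rpow_neg] at hvel ⊢
    have hmono : Monotone fun r : ℕ => η * Real.log (1 + r) := by
      intro a b hab
      have : (a : ℝ) ≤ b := by exact_mod_cast hab
      exact mul_le_mul_of_nonneg_left (Real.log_le_log (by positivity) (by linarith)) hη.1.le
    have := hvel.bosonicClustering hL hmono (by simp)
      (mul_pos hη.1 (Real.log_pos (by norm_num))) hpos hΔ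
    simpa only [div_mul_eq_mul_div] using this
  · refine strictMonoOn_velocity (fun μ hμ => IsExpDecaying.exists_isVelocityBound hμ)
      (fun μ r => by positivity) fun μ μ' hle r => ?_
    exact Real.exp_le_exp.2 (mul_le_mul_of_nonneg_right (by linarith) (by positivity))
  · have hvel := isVelocityBound_velocity (f := fun μ r => Real.exp (-μ * r)) hμ.1
      (fun r => by positivity) hμ.exists_isVelocityBound
    have hpos := velocity_pos (L := L) (h := h) (fun μ r => Real.exp (-μ * r)) hμ.1
    refine ⟨hpos, hvel, fun ΔE hΔ => ?_⟩
    set v := velocity L h (fun μ r => Real.exp (-μ * r)) μ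
    simp only [neg_mul] at hvel ⊢
    have hmono : Monotone fun r : ℕ => μ * (r : ℝ) := by
      intro a b hab
      have : (a : ℝ) ≤ b := by exact_mod_cast hab
      exact mul_le_mul_of_nonneg_left this hμ.1.le
    have := hvel.bosonicClustering hL hmono (by simp) (by simpa using hμ.1) hpos hΔ
    simpa only [div_mul_eq_mul_div] using this
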